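/- **Setting.** All algorithms are probabilistic polynomial-time (PPT) in a security parameter $n$; "negligible" means smaller than every inverse polynomial in $n$ for large $n$. *Oblivious transfer.* Let $\gamma=\gamma(n)$ be polynomially bounded and let $\mathrm{OT}^{\gamma}_1$ be a 1-out-of-$\gamma$ oblivious transfer protocol with a PPT honest receiver. It has *receiver security* if every PPT (possibly malicious) sender $\mathcal A$ has negligible advantage $|\Pr[\text{guess}=a]-1/2|$ in the following game: $\mathcal A$ names two indices $i,j\in\{1,\dots,\gamma\}$; a uniformly random bit $a$ is drawn; the honest receiver chooses the $i$-th string if $a=0$ and the $j$-th string if $a=1$ and runs one session of the protocol with $\mathcal A$; finally $\mathcal A$ guesses $a$. *AOT.* AOT is a three-level mix network. An honest user $A$ who sends a payload $x$ to $B$, with whom $A$ shares a secret $\sigma_{A,B}$, computes $M=E[p_B,(x,\text{nonce})]$ and the tag $k=f(\sigma_{A,B},c)$ ($E$ a public-key encryption scheme, $p_B$ the public key of $B$, $f$ a key-derivation function, $c$ a message counter), picks a Level-1 node $N_1$ and a Level-2 node $N_2$ by a PPT rule, and sends $\big(E[p_{N_2},(M,k,N_2,ts)],N_2\big)$ to $N_1$,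 where $ts$ is a time stamp. Level-3 nodes hold publication lists of $\gamma$ messages and post the tags. A user who recognizes a posted tag, by recomputing it from a shared secret, retrieves the message with $\mathrm{OT}^{\gamma}_1$ from that node, the node being the OT sender. Users also make *dummy requests*: OT sessions of the same form whose choice is an entry of the list selected by a fixed PPT rule. *Anonymity game.* The PPT adversary $\mathcal A$ plays all AOT nodes and all corrupted users; the challenger plays the honest users and holds a uniformly random bit $b$. As often as it likes, before and after the challenge, and with arbitrary interleaving, $\mathcal A$ may have honest users join (it learns their public keys), have pairs of users share secrets (it knows the secrets shared with corrupted users), announce a directory of nodes, have honest users send messages with payloads, counters and time stamps of its choice, post lists of tags and have honest users check an entry of such a list against a tag of theirs (for a counter value that $\mathcal A$ names) and retrieve the message if it matches, have honest users make dummy requests, and send arbitrary OT messages in any open session, to which the honest user replies as prescribed by $\mathrm{OT}^{\gamma}_1$. Once, $\mathcal A$ names two distinct honest users $c_0,c_1$ and a message $m$ in a publication list. Then $c_b$ is made the receiver of $m$ and retrieves it by OT, while $c_{1-b}$ makes a dummy request that pretends to ask for a message $m'$ of the list; $m'$ is disclosed to $\mathcal A$, which plays the sender in both OT sessions. Finally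 $\mathcal A$ outputs a guess for $b$; its advantage is $|\Pr[\text{guess}=b]-1/2|$. AOT has *receiver anonymity* if the advantage of every PPT adversary in this game is negligible. **Theorem.** If the oblivious transfer protocol used in AOT has receiver security, then AOT has receiver anonymity, even though the adversary (in particular, a covert one) controls all nodes of AOT. -/

import Mathlib

namespace ObliviousAnon

/-! ## Data: binary trees, used for all strings, keys, numbers, lists and messages -/

/-- Binary trees. `cons a b` is at once a pair and a list with head `a` and tail `b`. -/
inductive Data : Type
  | nil : Data
  | cons : Data → Data → Data
  deriving DecidableEq

namespace Data

/-- First component (`nil` for `nil`). -/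
def hd : Data → Data
  | nil => nil
  | cons a _ => a

/-- Second component (`nil` for `nil`). -/
def tl : Data → Data
  | nil => nil
  | cons _ b => b

/-- The unary numeral `1ⁿ`. -/
def num : ℕ → Data
  | 0 => nil
  | n + 1 => cons nil (num n)

/-- A tree read as a list. -/
def toList : Data → List Data
  | nil => []
  | cons a b => a :: b.toList

/-- A tree read as a unary number: the length of the list. -/
def toNat (d : Data) : ℕ := d.toList.length

/-- A truth value. -/
def ofBool : Bool → Data
  | false => nil
  | true => cons nil nil

end Data

/-! ## Probabilistic polynomial-time machines

A probabilistic WHILE-machine on binary trees with registers `0, 1, 2, …`. One step executes one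
command. With trees stored in memory with maximal sharing, every step (including the equality
test, which then compares two addresses) is carried out by a probabilistic Turing machine in time
polynomial in the number of steps made so far and the size of the input, and conversely, so that
polynomial time means the same as for Turing machines. -/

/-- Expressions, evaluated on the registers. -/
inductive Expr : Type
  | reg : ℕ → Expr
  | nil : Expr
  | cons : Expr → Expr → Expr
  | hd : Expr → Expr
  | tl : Expr → Expr
  | eq : Expr → Expr → Expr

/-- The contents of the registers. -/
abbrev Store : Type := ℕ → Data

/-- The value of an expression. -/
def Expr.eval (s : Store) : Expr → Data
  | .reg i => s i
  | .nil => .nil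
  | .cons e f => .cons (e.eval s) (f.eval s)
  | .hd e => (e.eval s).hd
  | .tl e => (e.eval s).tl
  | .eq e f => .ofBool (decide (e.eval s = f.eval s))

/-- Commands. `flip x` puts a fair coin into register `x`; `call x` sends the contents of register
`x` to the party the machine interacts with and replaces it by the answer; `loop e c` repeats `c`
as long as `e` is not `nil`. -/
inductive Cmd : Type
  | assign : ℕ → Expr → Cmd
  | flip : ℕ → Cmd
  | call : ℕ → Cmd
  | seq : Cmd → Cmd → Cmd
  | cond : Expr → Cmd → Cmd → Cmd
  | loop : Expr → Cmd → Cmd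

/-- A configuration: the commands still to be executed, and the registers. -/
structure Config : Type where
  todo : List Cmd
  store : Store

/-- The next configuration, given the coin and the answer that the step uses if it is a `flip` or a
`call`. A machine with nothing left to do has halted and stays where it is. -/
def Config.next (coin : Bool) (ans : Data) (c : Config) : Config :=
  match c.todo with
  | [] => c
  | .assign x e :: k => ⟨k, Function.update c.store x (e.eval c.store)⟩
  | .flip x :: k => ⟨k, Function.update c.store x (Data.ofBool coin)⟩
  | .call x :: k => ⟨k, Function.update c.store x ans⟩
  | .seq a b :: k => ⟨a :: b :: k, c.store⟩
  | .cond e a b :: k => ⟨(if e.eval c.store = .nil then b else a) :: k, c.store⟩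
  | .loop e a :: k => ⟨if e.eval c.store = .nil then k else a :: .loop e a :: k, c.store⟩

/-- `Halts t c`: started in `c`, the machine has halted after at most `t` steps, whatever the coins
and whatever the answers it receives. -/
def Halts : ℕ → Config → Prop
  | 0, c => c.todo = []
  | t + 1, c => ∀ (coin : Bool) (ans : Data), Halts t (c.next coin ans)

/-- The initial configuration: input in register `0`, all other registers `nil`. -/
def Cmd.start (p : Cmd) (input : Data) : Config :=
  ⟨[p], Function.update (fun _ => Data.nil) 0 input⟩

/-- A (possibly interactive) probabilistic polynomial-time algorithm: on security parameter `n` and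
any further input from `Inp n` it halts within `time n` steps, for a polynomial `time`. -/
structure PPT (Inp : ℕ → Set Data) : Type where
  code : Cmd
  time : Polynomial ℕ
  halts : ∀ n, ∀ d ∈ Inp n, Halts (time.eval n) (code.start (.cons (.num n) d))

/-- A stateful randomized party that answers messages. -/
abbrev Party (σ : Type) : Type := σ → Data → PMF (σ × Data)

/-- One step of a machine that interacts with the party `O`, with a fresh fair coin. -/
noncomputable def step {σ : Type} (O : Party σ) (cs : Config × σ) : PMF (Config × σ) :=
  match cs.1.todo with
  | .call x :: _ =>
      (O cs.2 (cs.1.store x)).map fun r => (cs.1.next false r.2, r.1)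
  | _ => (PMF.uniformOfFintype Bool).map fun coin => (cs.1.next coin .nil, cs.2)

/-- `t` steps. -/
noncomputable def steps {σ : Type} (O : Party σ) : ℕ → Config × σ → PMF (Config × σ)
  | 0, cs => PMF.pure cs
  | t + 1, cs => (step O cs).bind (steps O t)

/-- The output (register `0` after halting) of a machine on security parameter `n` and further
input `d`, interacting with the party `O` that starts in state `s`. -/
noncomputable def PPT.interact {Inp : ℕ → Set Data} (A : PPT Inp) {σ : Type} (O : Party σ) (s : σ)
    (n : ℕ) (d : Data) : PMF Data :=
  (steps O (A.time.eval n) (A.code.start (.cons (.num n) d), s)).map fun cs => cs.1.store 0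

/-- A non-interactive PPT algorithm, defined on all inputs. -/
abbrev Alg : Type := PPT fun _ => Set.univ

/-- The output distribution of an algorithm; there is nobody to call. -/
noncomputable def Alg.run (A : Alg) (n : ℕ) (d : Data) : PMF Data :=
  PPT.interact A (fun (_ : Unit) _ => PMF.pure ((), Data.nil)) () n d

/-- Negligible functions of the security parameter. -/
def Negligible (f : ℕ → ℝ) : Prop :=
  Asymptotics.SuperpolynomialDecay Filter.atTop (fun n : ℕ => (n : ℝ)) f

/-- The probability that a guess, interacting with a party that holds a uniformly random bit,
equals that bit. The machine is given the security parameter and the input `d`; its guess is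
`true` if and only if it outputs something other than `nil`. -/
noncomputable def guessProb {Inp : ℕ → Set Data} (A : PPT Inp) {σ : Type} (O : Bool → Party σ)
    (s : σ) (n : ℕ) (d : Data) : ℝ :=
  (((PMF.uniformOfFintype Bool).bind fun b =>
    (A.interact (O b) s n d).map fun out => decide (out ≠ .nil) == b) true).toReal

/-! ## 1-out-of-`m` oblivious transfer and receiver security -/

/-- A 1-out-of-`m` oblivious transfer protocol, `m = size n` polynomially bounded, as seen by a
malicious sender. `receiver` is the honest receiver's next-message algorithm: from `1ᵐ`, the
receiver's choice, its internal state (initially `nil`) and an incoming message it computes its new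
state (where it also keeps the string it obtains) and its reply. A receiver that speaks first does
so in reply to an empty message. The honest sender plays no role in receiver security. -/
structure OT : Type where
  size : ℕ → ℕ
  size_le : ∃ p : Polynomial ℕ, ∀ n, size n ≤ p.eval n
  receiver : Alg

/-- A session of an honest receiver: its choice (from `0, …, m - 1`) and its internal state. -/
structure Session : Type where
  choice : ℕ
  state : Data

/-- The honest receiver handles an incoming message; returns the new session and the reply. -/
noncomputable def OT.respond (ot : OT) (n : ℕ) (s : Session) (msg : Data) :
    PMF (Session × Data) := do
  let r ← ot.receiver.run n
    (.cons (.num (ot.size n)) (.cons (.num s.choice) (.cons s.state msg)))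
  return (⟨s.choice, r.hd⟩, r.tl)

/-- The PPT machines that play against a protocol: besides `1ⁿ` they are given `1ᵐ`. -/
abbrev OT.Adversary (ot : OT) : Type := PPT fun n => {Data.num (ot.size n)}

/-- The honest receiver in the receiver-security game with bit `a`. The malicious sender first
names two indices `i, j < m`; the receiver chooses `i` (if `a = false`) or `j` (if `a = true`), and
from then on takes part in one session of the protocol with the sender. -/
noncomputable def OT.challenger (ot : OT) (n : ℕ) (a : Bool) : Party (Option Session) :=
  fun st q =>
    match st with
    | none =>
        let i := q.hd.toNat
        let j := q.tl.toNat
        if i < ot.size n ∧ j < ot.size n then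
          return (some ⟨if a then j else i, .nil⟩, Data.ofBool true)
        else
          return (none, .nil)
    | some s => do
        let r ← ot.respond n s q
        return (some r.1, r.2)

/-- The advantage of a malicious sender in telling which of the two indices was chosen. -/
noncomputable def OT.advantage (ot : OT) (A : ot.Adversary) (n : ℕ) : ℝ :=
  |guessProb A (ot.challenger n) none n (.num (ot.size n)) - 1 / 2|

/-- Receiver security: no PPT sender can tell which of two indices the receiver chose. -/
def OT.ReceiverSecurity (ot : OT) : Prop :=
  ∀ A : ot.Adversary, Negligible (ot.advantage A)

/-! ## AOT: the honest users

All nodes of Levels 1, 2 and 3 belong to the adversary, as do the corrupted users, so that the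
protocol is described by what an honest user's application does. -/

/-- The ingredients of AOT. No security is assumed of any of them.
* `ot`: the oblivious transfer protocol by which messages are delivered; its size is the length
  `γ` of the publication lists;
* `keyGen`: key generation, outputs `(public key, secret key)`;
* `enc`: public-key encryption `E[p, M]`, input `(p, M)`;
* `kdf`: the key-derivation function `f(σ, c)`, input `(σ, c)`;
* `secretGen`, `nonceGen`: generation of shared secrets and of nonces;
* `route`: the sender's random choice of a Level-1 node and a Level-2 node from the public
  directory of nodes, outputs `(N₁, (N₂, public key of N₂))`;
* `dummyChoice`: the (random) choice of an entry of a publication list by a dummy request. -/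
structure AOT : Type where
  ot : OT
  keyGen : Alg
  enc : Alg
  kdf : Alg
  secretGen : Alg
  nonceGen : Alg
  route : Alg
  dummyChoice : Alg

/-- What an honest user's application stores about one of its communication partners: the partner's
public key and the shared secret. -/
structure Contact : Type where
  owner : ℕ
  peerKey : Data
  secret : Data

/-- An OT session opened by an honest user with a Level-3 node. -/
structure Request : Type where
  user : ℕ
  session : Session

/-- The joint state of the honest users. `users` lists the key pairs of the honest users,
`directory` is the public directory of nodes, and `challenged` records whether the challenge has
taken place. -/
structure Users : Type where
  users : List Data
  contacts : List Contact
  directory : Data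
  requests : List Request
  challenged : Bool

/-- The state before anything has happened. -/
def Users.init : Users := ⟨[], [], .nil, [], false⟩

/-- A user opens an OT session with choice `i`. -/
def Users.openRequest (st : Users) (u i : ℕ) : Users :=
  { st with requests := st.requests ++ [⟨u, ⟨i, .nil⟩⟩] }

namespace AOT

variable (P : AOT)

/-- `γ`, the number of messages in a publication list, at security parameter `n`. -/
def γ (n : ℕ) : ℕ := P.ot.size n

/-- The message that a user sends to AOT in order to deliver the payload `x` to a partner:
with `M = E[p_B, (x, nonce)]` and tag `k = f(σ, c)`, the sender transmits
`(E[p_{N₂}, (M, k, N₂, ts)], N₂)` to the Level-1 node `N₁`. Returns `N₁` and this message. -/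
noncomputable def compose (n : ℕ) (directory : Data) (B : Contact) (x c ts : Data) :
    PMF Data := do
  let r ← P.route.run n directory
  let nonce ← P.nonceGen.run n .nil
  let M ← P.enc.run n (.cons B.peerKey (.cons x nonce))
  let k ← P.kdf.run n (.cons B.secret c)
  let node₁ := r.hd
  let node₂ := r.tl.hd
  let key₂ := r.tl.tl
  let e ← P.enc.run n (.cons key₂ (.cons M (.cons k (.cons node₂ ts))))
  return .cons node₁ (.cons e node₂)

/-- The entry of the posted list of tags that a dummy request pretends to ask for. -/
noncomputable def dummyIndex (n : ℕ) (board : Data) : PMF ℕ :=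
  (P.dummyChoice.run n board).map fun d => if d.toNat < P.γ n then d.toNat else 0

end AOT

/-- What the adversary can make happen in the game. A `board` is the list of the `γ` tags that a
Level-3 node has posted for the messages in its publication list.
* `newUser`: a new honest user joins, and its public key becomes known;
* `meet u v`: the honest users `u` and `v` share a fresh secret;
* `meetCorrupt u key secret`: the honest user `u` shares a secret with a corrupted user;
* `setDirectory`: the adversary's nodes announce their names and public keys;
* `send k x c ts`: the owner of contact `k` sends payload `x` to that partner, with message counter
  `c` and time stamp `ts`;
* `fetch k c board i`: the owner of contact `k` checks whether entry `i` of the board is the tag for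
  counter `c` and, if so, starts to retrieve the message by OT;
* `dummy u board`: user `u` makes a dummy request;
* `deliver r msg`: the node sends the OT message `msg` in the `r`-th session;
* `challenge u₀ u₁ board i`: see `Users.answer`. -/
inductive Query : Type
  | newUser
  | meet (u v : ℕ)
  | meetCorrupt (u : ℕ) (key secret : Data)
  | setDirectory (d : Data)
  | send (k : ℕ) (x c ts : Data)
  | fetch (k : ℕ) (c board : Data) (i : ℕ)
  | dummy (u : ℕ) (board : Data)
  | deliver (r : ℕ) (msg : Data)
  | challenge (u₀ u₁ : ℕ) (board : Data) (i : ℕ)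

/-- How a query is written as a message: the number of its kind, followed by its arguments. -/
def Query.decode (d : Data) : Query :=
  let a := d.tl
  match d.hd.toNat with
  | 0 => .newUser
  | 1 => .meet a.hd.toNat a.tl.toNat
  | 2 => .meetCorrupt a.hd.toNat a.tl.hd a.tl.tl
  | 3 => .setDirectory a
  | 4 => .send a.hd.toNat a.tl.hd a.tl.tl.hd a.tl.tl.tl
  | 5 => .fetch a.hd.toNat a.tl.hd a.tl.tl.hd a.tl.tl.tl.toNat
  | 6 => .dummy a.hd.toNat a.tl
  | 7 => .deliver a.hd.toNat a.tl
  | _ => .challenge a.hd.toNat a.tl.hd.toNat a.tl.tl.hd a.tl.tl.tl.toNat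

namespace AOT

variable (P : AOT)

/-- The challenger in the anonymity game with bit `b` answers a query on behalf of the honest users.
Meaningless queries change nothing and are answered by `nil`.

In the challenge the adversary names two distinct honest users `u₀`, `u₁` and the message `m` at
position `i` of a publication list. Of these two, `u_b` becomes the receiver of `m` and starts to
retrieve it by OT, while `u_{1-b}` makes a dummy request that pretends to ask for the message `m'` at
position `j` of the list; `j` is disclosed to the adversary. The first of the two new OT sessions is
that of `u₀`, the second one that of `u₁`. There is one challenge. -/
noncomputable def answer (n : ℕ) (b : Bool) (st : Users) : Query → PMF (Users × Data)
  | .newUser => do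
      let keys ← P.keyGen.run n .nil
      return ({ st with users := st.users ++ [keys] }, .cons .nil keys.hd)
  | .meet u v =>
      match st.users[u]?, st.users[v]? with
      | some keysU, some keysV => do
          let s ← P.secretGen.run n .nil
          return ({ st with contacts := st.contacts ++ [⟨u, keysV.hd, s⟩, ⟨v, keysU.hd, s⟩] },
            .ofBool true)
      | _, _ => return (st, .nil)
  | .meetCorrupt u key s =>
      match st.users[u]? with
      | some _ => return ({ st with contacts := st.contacts ++ [⟨u, key, s⟩] }, .ofBool true)
      | none => return (st, .nil)
  | .setDirectory d => return ({ st with directory := d }, .ofBool true)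
  | .send k x c ts =>
      match st.contacts[k]? with
      | some B => do
          let m ← P.compose n st.directory B x c ts
          return (st, m)
      | none => return (st, .nil)
  | .fetch k c board i =>
      match st.contacts[k]?, board.toList[i]? with
      | some B, some tag => do
          let t ← P.kdf.run n (.cons B.secret c)
          if board.toList.length = P.γ n ∧ tag = t then
            return (st.openRequest B.owner i, .ofBool true)
          else
            return (st, .nil)
      | _, _ => return (st, .nil)
  | .dummy u board =>
      if u < st.users.length ∧ board.toList.length = P.γ n then do
        let j ← P.dummyIndex n board
        return (st.openRequest u j, .ofBool true)
      else
        return (st, .nil)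
  | .deliver r msg =>
      match st.requests[r]? with
      | some q => do
          let a ← P.ot.respond n q.session msg
          return ({ st with requests := st.requests.set r ⟨q.user, a.1⟩ }, a.2)
      | none => return (st, .nil)
  | .challenge u₀ u₁ board i =>
      if st.challenged = false ∧ u₀ < st.users.length ∧ u₁ < st.users.length ∧ u₀ ≠ u₁ ∧
          board.toList.length = P.γ n ∧ i < P.γ n then do
        let j ← P.dummyIndex n board
        let st₀ := st.openRequest u₀ (if b then j else i)
        let st₁ := st₀.openRequest u₁ (if b then i else j)
        return ({ st₁ with challenged := true }, .cons .nil (.num j))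
      else
        return (st, .nil)

/-- The challenger in the anonymity game with bit `b`. -/
noncomputable def challenger (n : ℕ) (b : Bool) : Party Users :=
  fun st q => P.answer n b st (Query.decode q)

/-- The adversary's advantage in the anonymity game. The adversary is a PPT machine that plays all
nodes and all corrupted users; its guess is its output. -/
noncomputable def advantage (A : P.ot.Adversary) (n : ℕ) : ℝ :=
  |guessProb A (P.challenger n) Users.init n (.num (P.γ n)) - 1 / 2|

/-- Receiver anonymity. -/
def ReceiverAnonymity : Prop :=
  ∀ A : P.ot.Adversary, Negligible (P.advantage A)

end AOT

end ObliviousAnon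

/-!
Receiver anonymity is reduced to receiver security by a hybrid argument. The two games of the
anonymity experiment differ in the choices of the two OT sessions that the challenge opens: `(m,
m')` if the bit is false, and `(m', m)` if it is true. Between them lies the hybrid game in which
both sessions ask for `m'`, the message of the dummy request. Neighbouring games differ in one
session only, and a malicious OT sender can play either pair of them: it runs the adversary, plays
all honest users itself, and in the challenge names `m` and `m'` (for the first session) or `m'`
and `m` (for the second one) to the receiver in the OT game, to which it forwards the messages of
that session from then on (`AOT.sender_interact`). That the other new session always asks for
`m'`, which the adversary is told, is what lets the sender conduct it without knowing the bit. The
advantage in the anonymity game is at most the sum of the two advantages of these senders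
(`AOT.advantage_le`).

Most of the work is to exhibit the senders as machines that run in polynomial time whatever
answers they get. A machine is turned into part of another one by renaming its registers and
replacing each of its calls by code (`inline_implements`). This serves both for the algorithms of
AOT, as subroutines, and for the adversary, whose calls are replaced by the code of the honest
users. This code is written as a `Prog`, a language in which the only loop is iteration along a
clock, so that every program runs in polynomial time without any assumption on the data in its
registers (`Prog.compile_implements`). The clock grows with every call of the adversary and so
stays longer than the lists that the honest users keep; lists supplied by the adversary are only
ever read up to a length that the clock bounds.

That the answers of the program are distributed as in the hybrid games is expressed by couplings
(`Couples`), under the relation `Related` between the registers and the receiver in the OT game on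
the one hand and the joint state of the honest users on the other hand.
-/

namespace ObliviousAnon

/-! ### Trees as lists and numbers -/

namespace Data

@[simp] theorem hd_nil : Data.nil.hd = .nil := rfl

@[simp] theorem tl_nil : Data.nil.tl = .nil := rfl

@[simp] theorem hd_cons (a b : Data) : (Data.cons a b).hd = a := rfl

@[simp] theorem tl_cons (a b : Data) : (Data.cons a b).tl = b := rfl

@[simp] theorem toList_nil : Data.nil.toList = [] := rfl

@[simp] theorem toList_cons (a b : Data) : (Data.cons a b).toList = a :: b.toList := rfl

theorem toList_injective : Function.Injective Data.toList := by
  intro a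
  induction a with
  | nil => intro b h; cases b <;> simp_all [Data.toList]
  | cons a₁ a₂ _ ih =>
    intro b h
    cases b with
    | nil => simp [Data.toList] at h
    | cons b₁ b₂ =>
      simp only [Data.toList, List.cons.injEq] at h
      rw [h.1, ih h.2]

theorem toList_num (n : ℕ) : (Data.num n).toList = List.replicate n .nil := by
  induction n with
  | zero => rfl
  | succ n ih => rw [Data.num, Data.toList, ih, List.replicate_succ]

theorem toNat_tl (d : Data) : d.tl.toNat = d.toNat - 1 := by
  cases d <;> simp [Data.tl, Data.toNat, Data.toList]

theorem toNat_eq_zero {d : Data} : d.toNat = 0 ↔ d = .nil := by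
  cases d <;> simp [Data.toNat, Data.toList]

theorem toNat_num (n : ℕ) : (Data.num n).toNat = n := by
  induction n with
  | zero => rfl
  | succ n ih => exact congrArg (· + 1) ih

theorem getElem?_of_nil_eq_drop {d : List Data} {i : ℕ} (h : Data.nil.toList = d.drop i) :
    d[i]? = none ∧ d.length ≤ i := by
  have := List.drop_eq_nil_iff.1 h.symm
  exact ⟨List.getElem?_eq_none this, this⟩

theorem getElem?_of_cons_eq_drop {d : List Data} {i : ℕ} {e r : Data}
    (h : (Data.cons e r).toList = d.drop i) :
    d[i]? = some e ∧ i < d.length := by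
  have h₁ : d[i]? = some e := by
    have := List.getElem?_drop (xs := d) (i := i) (j := 0)
    rw [Nat.add_zero, ← h] at this
    exact this.symm
  exact ⟨h₁, (List.getElem?_eq_some_iff.1 h₁).1⟩

end Data

/-! ### Halting and the observable behaviour of machines -/

section

theorem Halts.succ {t : ℕ} {c : Config} (h : Halts t c) : Halts (t + 1) c := by
  induction t generalizing c with
  | zero =>
    intro coin ans
    have h' : c.todo = [] := h
    simpa [Config.next, h'] using h
  | succ t ih => exact fun coin ans => ih (h coin ans)

theorem Halts.mono {t t' : ℕ} {c : Config} (h : Halts t c) (ht : t ≤ t') : Halts t' c := by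
  induction ht with
  | refl => exact h
  | step _ ih => exact ih.succ

variable {σ : Type}

theorem step_of_todo_eq_nil (O : Party σ) {c : Config} (h : c.todo = []) (x : σ) :
    step O (c, x) = PMF.pure (c, x) := by
  simp only [step, h, Config.next]
  exact PMF.map_const _ _

theorem step_of_not_call (O : Party σ) {c : Cmd} {k : List Cmd} {s : Store} {c' : Config}
    (hc : ∀ r, c ≠ .call r) (h : ∀ coin ans, Config.next coin ans ⟨c :: k, s⟩ = c') (x : σ) :
    step O (⟨c :: k, s⟩, x) = PMF.pure (c', x) := by
  simp only [step, h]
  split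
  · next h' => exact absurd (List.cons.inj h').1 (hc _)
  · exact PMF.map_const _ _

theorem steps_succ_of_halts (O : Party σ) {t : ℕ} {c : Config} (h : Halts t c) (x : σ) :
    steps O (t + 1) (c, x) = steps O t (c, x) := by
  induction t generalizing c x with
  | zero =>
    have h' : c.todo = [] := h
    simp only [steps]
    rw [step_of_todo_eq_nil O h', PMF.pure_bind]
  | succ t ih =>
    rw [steps, steps]
    simp only [step]
    split
    · simp only [PMF.bind_map, Function.comp_def]
      congr 1; funext r
      exact ih (h _ _) _
    · simp only [PMF.bind_map, Function.comp_def]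
      congr 1; funext r
      exact ih (h _ _) _

theorem steps_of_halts (O : Party σ) {t t' : ℕ} {c : Config} (h : Halts t c) (ht : t ≤ t') (x : σ) :
    steps O t' (c, x) = steps O t (c, x) := by
  induction ht with
  | refl => rfl
  | step hle ih => rw [steps_succ_of_halts O (h.mono hle), ih]

/-- The distribution of register `0` after `t` steps, as a function of the commands still to be
executed, the registers and the state of the party. -/
noncomputable def obs (O : Party σ) (t : ℕ) (k : List Cmd) (s : Store) (x : σ) : PMF Data :=
  (steps O t (⟨k, s⟩, x)).map fun cs => cs.1.store 0

theorem obs_of_halts (O : Party σ) {t t' : ℕ} {k : List Cmd} {s : Store} (h : Halts t ⟨k, s⟩)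
    (ht : t ≤ t') (x : σ) : obs O t' k s x = obs O t k s x := by
  rw [obs, obs, steps_of_halts O h ht]

theorem obs_succ (O : Party σ) (t : ℕ) (k : List Cmd) (s : Store) (x : σ) :
    obs O (t + 1) k s x =
      (step O (⟨k, s⟩, x)).bind fun cs => obs O t cs.1.todo cs.1.store cs.2 := by
  simp only [obs, steps, PMF.map_bind]

theorem obs_succ_assign (O : Party σ) (t : ℕ) (r : ℕ) (e : Expr) (k : List Cmd) (s : Store)
    (x : σ) :
    obs O (t + 1) (.assign r e :: k) s x = obs O t k (Function.update s r (e.eval s)) x := by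
  rw [obs_succ]
  simp only [step, Config.next, PMF.bind_map, Function.comp_def, PMF.bind_const]

theorem obs_succ_flip (O : Party σ) (t : ℕ) (r : ℕ) (k : List Cmd) (s : Store) (x : σ) :
    obs O (t + 1) (.flip r :: k) s x = (PMF.uniformOfFintype Bool).bind fun b =>
      obs O t k (Function.update s r (Data.ofBool b)) x := by
  rw [obs_succ]
  simp only [step, Config.next, PMF.bind_map, Function.comp_def]

theorem obs_succ_call (O : Party σ) (t : ℕ) (r : ℕ) (k : List Cmd) (s : Store) (x : σ) :
    obs O (t + 1) (.call r :: k) s x = (O x (s r)).bind fun a =>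
      obs O t k (Function.update s r a.2) a.1 := by
  rw [obs_succ]
  simp only [step, Config.next, PMF.bind_map, Function.comp_def]

theorem obs_succ_seq (O : Party σ) (t : ℕ) (a b : Cmd) (k : List Cmd) (s : Store) (x : σ) :
    obs O (t + 1) (.seq a b :: k) s x = obs O t (a :: b :: k) s x := by
  rw [obs_succ]
  simp only [step, Config.next, PMF.bind_map, Function.comp_def, PMF.bind_const]

theorem obs_succ_cond (O : Party σ) (t : ℕ) (e : Expr) (a b : Cmd) (k : List Cmd) (s : Store)
    (x : σ) :
    obs O (t + 1) (.cond e a b :: k) s x =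
      obs O t ((if e.eval s = .nil then b else a) :: k) s x := by
  rw [obs_succ]
  simp only [step, Config.next, PMF.bind_map, Function.comp_def, PMF.bind_const]

theorem obs_succ_loop (O : Party σ) (t : ℕ) (e : Expr) (a : Cmd) (k : List Cmd) (s : Store)
    (x : σ) :
    obs O (t + 1) (.loop e a :: k) s x =
      obs O t (if e.eval s = .nil then k else a :: .loop e a :: k) s x := by
  rw [obs_succ]
  simp only [step, Config.next, PMF.bind_map, Function.comp_def, PMF.bind_const]

/-! ### A program logic for commands -/

/-- `Implements O c s t Rel μ`: from the store `s`, the command `c` takes at most `t` steps, whatever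
the coins and answers, and it samples from `μ`, which may use the party `O`. An outcome `a` of `μ` is
left behind as any store `s'` with `Rel a s'`. The continuation-passing form accounts for the junk
that different runs leave in the registers, and `Rel` is required of every run, also of those with
answers that `O` never gives. -/
def Implements {α : Type} (O : Party σ) (c : Cmd) (s : Store) (t : ℕ) (Rel : α → Store → Prop)
    (μ : σ → PMF (α × σ)) : Prop :=
  ∀ (k : List Cmd) (t' : ℕ) (g : α → σ → PMF Data),
    (∀ a s', Rel a s' → Halts t' ⟨k, s'⟩ ∧ ∀ x, obs O t' k s' x = g a x) →
    Halts (t + t') ⟨c :: k, s⟩ ∧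
      ∀ x, obs O (t + t') (c :: k) s x = (μ x).bind fun r => g r.1 r.2

namespace Implements

variable {O : Party σ} {α β : Type}

theorem mono {c : Cmd} {s : Store} {t₁ t₂ : ℕ} {R₁ R₂ : α → Store → Prop} {μ : σ → PMF (α × σ)}
    (h : Implements O c s t₁ R₁ μ) (ht : t₁ ≤ t₂) (hR : ∀ a s', R₁ a s' → R₂ a s') :
    Implements O c s t₂ R₂ μ := by
  intro k t' g hg
  obtain ⟨h₁, h₂⟩ := h k t' g fun a s' hs => hg a s' (hR a s' hs)
  have hle : t₁ + t' ≤ t₂ + t' := by omega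
  exact ⟨h₁.mono hle, fun x => by rw [obs_of_halts O h₁ hle, h₂]⟩

theorem assign (r : ℕ) (e : Expr) (s : Store) {Rel : α → Store → Prop} {a : α}
    (h : Rel a (Function.update s r (e.eval s))) :
    Implements O (.assign r e) s 1 Rel fun x => PMF.pure (a, x) := by
  intro k t' g hg
  obtain ⟨h₁, h₂⟩ := hg _ _ h
  rw [Nat.add_comm]
  exact ⟨fun _ _ => h₁, fun x => by rw [obs_succ_assign, h₂, PMF.pure_bind]⟩

theorem call (r : ℕ) (s : Store) {Rel : Data → Store → Prop}
    (h : ∀ a, Rel a (Function.update s r a)) :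
    Implements O (.call r) s 1 Rel fun x => (O x (s r)).map fun a => (a.2, a.1) := by
  intro k t' g hg
  rw [Nat.add_comm]
  refine ⟨fun _ a => (hg _ _ (h a)).1, fun x => ?_⟩
  rw [obs_succ_call, PMF.bind_map]
  congr 1; funext a
  exact (hg _ _ (h a.2)).2 _

theorem seq {a b : Cmd} {s : Store} {t₁ t₂ : ℕ} {R₁ : α → Store → Prop} {R₂ : β → Store → Prop}
    {μ : σ → PMF (α × σ)} {ν : α → σ → PMF (β × σ)} (h₁ : Implements O a s t₁ R₁ μ)
    (h₂ : ∀ r s', R₁ r s' → Implements O b s' t₂ R₂ (ν r)) :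
    Implements O (.seq a b) s (1 + t₁ + t₂) R₂ fun x => (μ x).bind fun r => ν r.1 r.2 := by
  intro k t' g hg
  obtain ⟨h₃, h₄⟩ := h₁ (b :: k) (t₂ + t') (fun r x => (ν r x).bind fun r => g r.1 r.2)
    fun r s' hs => h₂ r s' hs k t' g hg
  have e : 1 + t₁ + t₂ + t' = (t₁ + (t₂ + t')) + 1 := by omega
  rw [e]
  exact ⟨fun _ _ => h₃, fun x => by rw [obs_succ_seq, h₄, PMF.bind_bind]⟩

theorem cond {e : Expr} {a b : Cmd} {s : Store} {t : ℕ} {Rel : α → Store → Prop}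
    {μ : σ → PMF (α × σ)} (h : Implements O (if e.eval s = .nil then b else a) s t Rel μ) :
    Implements O (.cond e a b) s (1 + t) Rel μ := by
  intro k t' g hg
  obtain ⟨h₁, h₂⟩ := h k t' g hg
  have e : 1 + t + t' = (t + t') + 1 := by omega
  rw [e]
  exact ⟨fun _ _ => h₁, fun x => by rw [obs_succ_cond, h₂]⟩

theorem loop_nil {e : Expr} {c : Cmd} {s : Store} {Rel : α → Store → Prop} {a : α}
    (he : e.eval s = .nil) (h : Rel a s) :
    Implements O (.loop e c) s 1 Rel fun x => PMF.pure (a, x) := by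
  intro k t' g hg
  obtain ⟨h₁, h₂⟩ := hg _ _ h
  rw [Nat.add_comm]
  refine ⟨fun _ _ => ?_, fun x => ?_⟩
  · simpa [Config.next, he] using h₁
  · rw [obs_succ_loop, if_pos he, h₂, PMF.pure_bind]

theorem loop_cons {e : Expr} {c : Cmd} {s : Store} {t₁ t₂ : ℕ} {R₁ : α → Store → Prop}
    {R₂ : β → Store → Prop} {μ : σ → PMF (α × σ)} {ν : α → σ → PMF (β × σ)}
    (he : e.eval s ≠ .nil) (h₁ : Implements O c s t₁ R₁ μ)
    (h₂ : ∀ r s', R₁ r s' → Implements O (.loop e c) s' t₂ R₂ (ν r)) :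
    Implements O (.loop e c) s (1 + t₁ + t₂) R₂ fun x => (μ x).bind fun r => ν r.1 r.2 := by
  intro k t' g hg
  obtain ⟨h₃, h₄⟩ := h₁ (.loop e c :: k) (t₂ + t') (fun r x => (ν r x).bind fun r => g r.1 r.2)
    fun r s' hs => h₂ r s' hs k t' g hg
  have e : 1 + t₁ + t₂ + t' = (t₁ + (t₂ + t')) + 1 := by omega
  rw [e]
  refine ⟨fun _ _ => ?_, fun x => ?_⟩
  · simpa [Config.next, he] using h₃
  · rw [obs_succ_loop, if_neg he, h₄, PMF.bind_bind]

end Implements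

/-! ### Couplings -/

/-- `p` and `q` can be sampled jointly so that the outcomes are related by `R`, expressed through
continuations: related outcomes may be continued in the same way. -/
def Couples {α β : Type} (p : PMF α) (q : PMF β) (R : α → β → Prop) : Prop :=
  ∀ (δ : Type) (g : α → PMF δ) (g' : β → PMF δ), (∀ a b, R a b → g a = g' b) →
    p.bind g = q.bind g'

namespace Couples

variable {α β α' β' : Type}

theorem pure {a : α} {b : β} {R : α → β → Prop} (h : R a b) :
    Couples (PMF.pure a) (PMF.pure b) R := by
  intro δ g g' hg
  rw [PMF.pure_bind, PMF.pure_bind, hg a b h]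

theorem bind {p : PMF α} {q : PMF β} {R : α → β → Prop} {f : α → PMF α'} {f' : β → PMF β'}
    {R' : α' → β' → Prop} (h : Couples p q R) (hf : ∀ a b, R a b → Couples (f a) (f' b) R') :
    Couples (p.bind f) (q.bind f') R' := by
  intro δ g g' hg
  rw [PMF.bind_bind, PMF.bind_bind]
  exact h _ _ _ fun a b hab => hf a b hab _ _ _ hg

theorem refl (p : PMF α) : Couples p p Eq := by
  intro δ g g' hg
  congr 1; funext a
  exact hg a a rfl

/-- Sampling from the same distribution on both sides. -/
theorem bind_same {p : PMF α} {f : α → PMF α'} {f' : α → PMF β'} {R' : α' → β' → Prop}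
    (hf : ∀ a, Couples (f a) (f' a) R') : Couples (p.bind f) (p.bind f') R' :=
  (refl p).bind fun a _ hab => hab ▸ hf a

theorem map {p : PMF α} {q : PMF β} {R : α → β → Prop} {f : α → α'} {f' : β → β'}
    {R' : α' → β' → Prop} (h : Couples p q R) (hf : ∀ a b, R a b → R' (f a) (f' b)) :
    Couples (p.map f) (q.map f') R' :=
  h.bind fun a b hab => .pure (hf a b hab)

theorem eq_map {p : PMF α} {q : PMF β} {R : α → β → Prop} (h : Couples p q R) {δ : Type}
    {f : α → δ} {f' : β → δ} (hf : ∀ a b, R a b → f a = f' b) : p.map f = q.map f' :=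
  h _ _ _ fun a b hab => congrArg PMF.pure (hf a b hab)

end Couples

/-- A machine cannot tell apart two parties whose answers are coupled, with states that remain
related. -/
theorem Couples.steps {σ₁ σ₂ : Type} {O₁ : Party σ₁} {O₂ : Party σ₂} {R : σ₁ → σ₂ → Prop}
    (hO : ∀ x₁ x₂ q, R x₁ x₂ →
      Couples (O₁ x₁ q) (O₂ x₂ q) fun r₁ r₂ => R r₁.1 r₂.1 ∧ r₁.2 = r₂.2)
    (t : ℕ) (c : Config) {x₁ : σ₁} {x₂ : σ₂} (hx : R x₁ x₂) :
    Couples (steps O₁ t (c, x₁)) (steps O₂ t (c, x₂)) fun r₁ r₂ => r₁.1 = r₂.1 ∧ R r₁.2 r₂.2 := by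
  induction t generalizing c x₁ x₂ with
  | zero => exact .pure ⟨rfl, hx⟩
  | succ t ih =>
    have hstep : Couples (step O₁ (c, x₁)) (step O₂ (c, x₂))
        fun r₁ r₂ => r₁.1 = r₂.1 ∧ R r₁.2 r₂.2 := by
      simp only [step]
      split
      · exact (hO _ _ _ hx).map fun a b hab => ⟨by rw [hab.2], hab.1⟩
      · exact (Couples.refl _).map fun _ _ hab => ⟨by rw [hab], hx⟩
    refine hstep.bind ?_
    rintro ⟨c₁, y₁⟩ ⟨c₂, y₂⟩ ⟨h₁, h₂⟩
    obtain rfl : c₁ = c₂ := h₁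
    exact ih _ h₂

end

/-! ### Inlining a machine into another one -/

/-- The expression with its registers renamed. -/
def Expr.rename (ρ : ℕ → ℕ) : Expr → Expr
  | .reg i => .reg (ρ i)
  | .nil => .nil
  | .cons e f => .cons (e.rename ρ) (f.rename ρ)
  | .hd e => .hd (e.rename ρ)
  | .tl e => .tl (e.rename ρ)
  | .eq e f => .eq (e.rename ρ) (f.rename ρ)

/-- All registers of the expression are less than `N`. -/
def Expr.Below (N : ℕ) : Expr → Prop
  | .reg i => i < N
  | .nil => True
  | .cons e f => e.Below N ∧ f.Below N
  | .hd e => e.Below N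
  | .tl e => e.Below N
  | .eq e f => e.Below N ∧ f.Below N

/-- The command with its registers renamed by `ρ` and `call x` replaced by `H x`. -/
def Cmd.inline (ρ : ℕ → ℕ) (H : ℕ → Cmd) : Cmd → Cmd
  | .assign x e => .assign (ρ x) (e.rename ρ)
  | .flip x => .flip (ρ x)
  | .call x => H x
  | .seq a b => .seq (a.inline ρ H) (b.inline ρ H)
  | .cond e a b => .cond (e.rename ρ) (a.inline ρ H) (b.inline ρ H)
  | .loop e a => .loop (e.rename ρ) (a.inline ρ H)

/-- All registers of the command are less than `N`. -/
def Cmd.Below (N : ℕ) : Cmd → Prop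
  | .assign x e => x < N ∧ e.Below N
  | .flip x => x < N
  | .call x => x < N
  | .seq a b => a.Below N ∧ b.Below N
  | .cond e a b => e.Below N ∧ a.Below N ∧ b.Below N
  | .loop e a => e.Below N ∧ a.Below N

theorem Expr.Below.mono {N M : ℕ} (h : N ≤ M) {e : Expr} (he : e.Below N) : e.Below M := by
  induction e with
  | reg i => exact lt_of_lt_of_le he h
  | nil => trivial
  | cons _ _ ih₁ ih₂ => exact ⟨ih₁ he.1, ih₂ he.2⟩
  | hd _ ih => exact ih he
  | tl _ ih => exact ih he
  | eq _ _ ih₁ ih₂ => exact ⟨ih₁ he.1, ih₂ he.2⟩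

theorem Cmd.Below.mono {N M : ℕ} (h : N ≤ M) {c : Cmd} (hc : c.Below N) : c.Below M := by
  induction c with
  | assign x e => exact ⟨lt_of_lt_of_le hc.1 h, hc.2.mono h⟩
  | flip x => exact lt_of_lt_of_le hc h
  | call x => exact lt_of_lt_of_le hc h
  | seq _ _ ih₁ ih₂ => exact ⟨ih₁ hc.1, ih₂ hc.2⟩
  | cond _ _ _ ih₁ ih₂ => exact ⟨hc.1.mono h, ih₁ hc.2.1, ih₂ hc.2.2⟩
  | loop _ _ ih => exact ⟨hc.1.mono h, ih hc.2⟩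

theorem Expr.exists_below (e : Expr) : ∃ N, e.Below N := by
  induction e with
  | reg i => exact ⟨i + 1, Nat.lt_succ_self i⟩
  | nil => exact ⟨0, trivial⟩
  | cons _ _ ih₁ ih₂ | eq _ _ ih₁ ih₂ =>
    obtain ⟨N, hN⟩ := ih₁
    obtain ⟨M, hM⟩ := ih₂
    exact ⟨max N M, hN.mono (le_max_left _ _), hM.mono (le_max_right _ _)⟩
  | hd _ ih | tl _ ih => exact ih

theorem Cmd.exists_below (c : Cmd) : ∃ N, c.Below N := by
  induction c with
  | assign x e =>
    obtain ⟨N, hN⟩ := e.exists_below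
    exact ⟨max (x + 1) N, le_max_left (x + 1) N, hN.mono (le_max_right _ _)⟩
  | flip x | call x => exact ⟨x + 1, Nat.lt_succ_self x⟩
  | seq _ _ ih₁ ih₂ =>
    obtain ⟨N, hN⟩ := ih₁
    obtain ⟨M, hM⟩ := ih₂
    exact ⟨max N M, hN.mono (le_max_left _ _), hM.mono (le_max_right _ _)⟩
  | cond e _ _ ih₁ ih₂ =>
    obtain ⟨K, hK⟩ := e.exists_below
    obtain ⟨N, hN⟩ := ih₁
    obtain ⟨M, hM⟩ := ih₂
    exact ⟨max K (max N M), hK.mono (le_max_left _ _), hN.mono (by simp), hM.mono (by simp)⟩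
  | loop e _ ih =>
    obtain ⟨N, hN⟩ := e.exists_below
    obtain ⟨M, hM⟩ := ih
    exact ⟨max N M, hN.mono (le_max_left _ _), hM.mono (le_max_right _ _)⟩

theorem Expr.eval_rename {ρ : ℕ → ℕ} {N : ℕ} {s v : Store} (h : ∀ i < N, s (ρ i) = v i) {e : Expr}
    (he : e.Below N) : (e.rename ρ).eval s = e.eval v := by
  induction e with
  | reg i => exact h i he
  | nil => rfl
  | cons _ _ ih₁ ih₂ | eq _ _ ih₁ ih₂ => simp only [rename, eval, ih₁ he.1, ih₂ he.2]
  | hd _ ih | tl _ ih => simp only [rename, eval, ih he]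

theorem update_rename {ρ : ℕ → ℕ} (hρ : Function.Injective ρ) {N : ℕ} {s v : Store}
    (h : ∀ i < N, s (ρ i) = v i) (x : ℕ) (d : Data) :
    ∀ i < N, Function.update s (ρ x) d (ρ i) = Function.update v x d i := by
  intro i hi
  rw [Function.update_apply, Function.update_apply, h i hi]
  simp only [hρ.eq_iff]

/-- A machine whose calls are replaced by code simulates the interaction of the machine with the
party that this code implements. The state of that party consists of a part `w : ω`, which the
invariant `Inv` ties to the registers, and of the state of the party `O` that the code calls. The
first argument of `Inv` bounds the number of calls still to come; the code may use it up in order to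
let the data in the registers grow. -/
theorem inline_implements {σ ω : Type} {O : Party σ} {O' : Party (ω × σ)} {ρ : ℕ → ℕ}
    (hρ : Function.Injective ρ) {N h : ℕ} (hh : 1 ≤ h) {H : ℕ → Cmd} {Inv : ℕ → ω → Store → Prop}
    (hupd : ∀ b w s i d, Inv b w s → Inv b w (Function.update s (ρ i) d))
    (hmono : ∀ b w s, Inv (b + 1) w s → Inv b w s)
    (hH : ∀ b w s x, Inv (b + 1) w s →
      Implements O (H x) s h
        (fun (r : ω × Data) s' => Inv b r.1 s' ∧ s' (ρ x) = r.2 ∧ ∀ i, i ≠ x → s' (ρ i) = s (ρ i))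
        (fun y => (O' (w, y) (s (ρ x))).map fun r => ((r.1.1, r.2), r.1.2)))
    (t : ℕ) (l : List Cmd) (v : Store) (w : ω) (s : Store) (hl : Halts t ⟨l, v⟩)
    (hN : ∀ c ∈ l, c.Below N) (hI : Inv t w s) (hs : ∀ i < N, s (ρ i) = v i)
    (k : List Cmd) (t' : ℕ) (g : Store → ω → σ → PMF Data)
    (hg : ∀ v' w' s', Inv 0 w' s' → (∀ i < N, s' (ρ i) = v' i) →
      Halts t' ⟨k, s'⟩ ∧ ∀ y, obs O t' k s' y = g v' w' y) :
    Halts (h * t + t') ⟨l.map (Cmd.inline ρ H) ++ k, s⟩ ∧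
      ∀ y, obs O (h * t + t') (l.map (Cmd.inline ρ H) ++ k) s y =
        (steps O' t (⟨l, v⟩, (w, y))).bind fun r => g r.1.store r.2.1 r.2.2 := by
  induction t generalizing l v w s with
  | zero =>
    obtain rfl : l = [] := hl
    simpa [steps, PMF.pure_bind] using hg v w s hI hs
  | succ t ih =>
    have hle : (h * t + t') + 1 ≤ h * (t + 1) + t' := by rw [Nat.mul_add]; omega
    have hle' : h * t + t' ≤ h * (t + 1) + t' := by omega
    cases l with
    | nil =>
      obtain ⟨h₁, h₂⟩ := ih [] v w s (hl false .nil) (by simp) (hmono _ _ _ hI) hs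
      refine ⟨h₁.mono hle', fun y => ?_⟩
      rw [obs_of_halts O h₁ hle', h₂, steps, step_of_todo_eq_nil O' rfl, PMF.pure_bind]
    | cons c l =>
      have hc := hN c (by simp)
      have hl' : ∀ c ∈ l, c.Below N := fun c' hc' => hN c' (by simp [hc'])
      -- one step of the simulated machine that is neither `flip` nor `call`
      have key : ∀ (l' : List Cmd) (v' s' : Store),
          (∀ coin ans, Config.next coin ans ⟨c :: l, v⟩ = ⟨l', v'⟩) →
          (∀ x, c ≠ .call x) → (∀ c' ∈ l', c'.Below N) → Inv (t + 1) w s' →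
          (∀ i < N, s' (ρ i) = v' i) →
          (∀ coin ans, Config.next coin ans ⟨c.inline ρ H :: (l.map (Cmd.inline ρ H) ++ k), s⟩ =
            ⟨l'.map (Cmd.inline ρ H) ++ k, s'⟩) →
          (∀ x, c.inline ρ H ≠ .call x) →
          Halts (h * (t + 1) + t') ⟨c.inline ρ H :: (l.map (Cmd.inline ρ H) ++ k), s⟩ ∧
          ∀ y, obs O (h * (t + 1) + t') (c.inline ρ H :: (l.map (Cmd.inline ρ H) ++ k)) s y =
            (steps O' (t + 1) (⟨c :: l, v⟩, (w, y))).bind fun r => g r.1.store r.2.1 r.2.2 := by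
        intro l' v' s' h₁ h₂ h₃ h₄ h₅ h₆ h₇
        obtain ⟨h₈, h₉⟩ := ih l' v' w s' (h₁ false .nil ▸ hl false .nil) h₃ (hmono _ _ _ h₄) h₅
        have h₁₀ : Halts ((h * t + t') + 1)
            ⟨c.inline ρ H :: (l.map (Cmd.inline ρ H) ++ k), s⟩ := fun coin ans => by
          rw [h₆]; exact h₈
        refine ⟨h₁₀.mono hle, fun y => ?_⟩
        rw [obs_of_halts O h₁₀ hle, obs_succ, steps]
        have e₁ : step O (⟨c.inline ρ H :: (l.map (Cmd.inline ρ H) ++ k), s⟩, y) =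
            PMF.pure (⟨l'.map (Cmd.inline ρ H) ++ k, s'⟩, y) := step_of_not_call O h₇ h₆ y
        have e₂ : step O' (⟨c :: l, v⟩, (w, y)) = PMF.pure (⟨l', v'⟩, (w, y)) :=
          step_of_not_call O' h₂ h₁ _
        rw [e₁, e₂, PMF.pure_bind, PMF.pure_bind]
        exact h₉ y
      rw [List.map_cons, List.cons_append]
      cases c with
      | assign x e =>
        refine key l (Function.update v x (e.eval v)) (Function.update s (ρ x) (e.eval v))
          (fun _ _ => rfl) (by simp) hl' (hupd _ _ _ _ _ hI) (update_rename hρ hs _ _) ?_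
          (by simp [Cmd.inline])
        intro _ _
        simp only [Cmd.inline, Config.next, Expr.eval_rename hs hc.2]
      | flip x =>
        have ih' := fun b => ih l (Function.update v x (Data.ofBool b)) w
          (Function.update s (ρ x) (Data.ofBool b)) (hl b .nil) hl'
          (hmono _ _ _ (hupd _ _ _ _ _ hI)) (update_rename hρ hs _ _)
        have h₁₀ : Halts ((h * t + t') + 1)
            ⟨Cmd.flip (ρ x) :: (l.map (Cmd.inline ρ H) ++ k), s⟩ := fun coin _ => (ih' coin).1
        refine ⟨h₁₀.mono hle, fun y => ?_⟩
        rw [Cmd.inline, obs_of_halts O h₁₀ hle, obs_succ_flip, steps]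
        simp only [step, Config.next, PMF.bind_map, PMF.bind_bind, Function.comp_def]
        congr 1; funext b
        exact (ih' b).2 y
      | call x =>
        have e : h * (t + 1) + t' = h + (h * t + t') := by ring
        rw [e]
        obtain ⟨h₁, h₂⟩ := hH t w s x hI (l.map (Cmd.inline ρ H) ++ k) (h * t + t')
          (fun r y => (steps O' t (⟨l, Function.update v x r.2⟩, (r.1, y))).bind
            fun r => g r.1.store r.2.1 r.2.2) (fun r s' hs' =>
              ih l (Function.update v x r.2) r.1 s' (hl false _) hl' hs'.1 (by
                intro i hi
                rw [Function.update_apply]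
                split_ifs with hix
                · rw [hix, hs'.2.1]
                · rw [hs'.2.2 i hix, hs i hi]))
        refine ⟨h₁, fun y => ?_⟩
        rw [Cmd.inline, h₂, steps]
        simp only [step, Config.next, PMF.bind_map, PMF.bind_bind, Function.comp_def, hs x hc]
      | seq a b =>
        exact key (a :: b :: l) v s (fun _ _ => rfl) (by simp)
          (by simpa using ⟨hc.1, hc.2, hl'⟩) hI hs (fun _ _ => rfl) (by simp [Cmd.inline])
      | cond e a b =>
        refine key ((if e.eval v = .nil then b else a) :: l) v s (fun _ _ => rfl) (by simp)
          ?_ hI hs ?_ (by simp [Cmd.inline])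
        · split_ifs
          · simpa using ⟨hc.2.2, hl'⟩
          · simpa using ⟨hc.2.1, hl'⟩
        · intro _ _
          simp only [Cmd.inline, Config.next, Expr.eval_rename hs hc.1]
          split_ifs <;> rfl
      | loop e a =>
        refine key (if e.eval v = .nil then l else a :: .loop e a :: l) v s (fun _ _ => rfl)
          (by simp) ?_ hI hs ?_ (by simp [Cmd.inline])
        · split_ifs
          · exact hl'
          · simpa using ⟨hc.2, hc, hl'⟩
        · intro _ _
          simp only [Cmd.inline, Config.next, Expr.eval_rename hs hc.1]
          split_ifs <;> rfl

/-! ### Programs with subroutines and bounded iteration -/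

namespace Implements

variable {σ α : Type} {O : Party σ}

theorem map {β : Type} {c : Cmd} {s : Store} {t : ℕ} {R₁ : α → Store → Prop}
    {R₂ : β → Store → Prop} {μ : σ → PMF (α × σ)} (h : Implements O c s t R₁ μ) (f : α → β)
    (hR : ∀ a s', R₁ a s' → R₂ (f a) s') :
    Implements O c s t R₂ fun x => (μ x).map fun r => (f r.1, r.2) := by
  intro k t' g hg
  obtain ⟨h₁, h₂⟩ := h k t' (fun a => g (f a)) fun a s' hs => hg _ _ (hR a s' hs)
  exact ⟨h₁, fun x => by rw [h₂, PMF.bind_map]; rfl⟩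

theorem seq_assign {r : ℕ} {e : Expr} {c : Cmd} {s : Store} {t : ℕ} {Rel : α → Store → Prop}
    {μ : σ → PMF (α × σ)} (h : Implements O c (Function.update s r (e.eval s)) t Rel μ) :
    Implements O (.seq (.assign r e) c) s (2 + t) Rel μ := by
  have := (Implements.assign (O := O) (a := ()) (Rel := fun _ s' => s' = _) r e s rfl).seq
    (R₂ := Rel) (t₂ := t) (b := c) (ν := fun _ => μ) (by rintro _ _ rfl; exact h)
  simpa only [PMF.pure_bind] using this

theorem assign_after {c : Cmd} {r : ℕ} {e : Expr} {s : Store} {t : ℕ} {R₁ R₂ : α → Store → Prop}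
    {μ : σ → PMF (α × σ)} (h : Implements O c s t R₁ μ)
    (hR : ∀ a s', R₁ a s' → R₂ a (Function.update s' r (e.eval s'))) :
    Implements O (.seq c (.assign r e)) s (t + 2) R₂ μ := by
  have := h.seq (R₂ := R₂) (t₂ := 1) (b := .assign r e) (ν := fun a x => PMF.pure (a, x))
    fun a s' hs => .assign _ _ _ (hR a s' hs)
  simp only [Prod.mk.eta, PMF.bind_pure] at this
  exact this.mono (by omega) fun _ _ => id

theorem seq_pure {a b : Cmd} {s : Store} {t₁ t₂ : ℕ} {R₁ : Unit → Store → Prop}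
    {R₂ : α → Store → Prop} {μ : σ → PMF (α × σ)}
    (h₁ : Implements O a s t₁ R₁ fun x => PMF.pure ((), x))
    (h₂ : ∀ s', R₁ () s' → Implements O b s' t₂ R₂ μ) :
    Implements O (.seq a b) s (1 + t₁ + t₂) R₂ μ := by
  have := h₁.seq (R₂ := R₂) (t₂ := t₂) (b := b) (ν := fun _ => μ) fun _ s' hs => h₂ s' hs
  simpa only [PMF.pure_bind] using this

end Implements

/-- Programs over their own registers, with calls of algorithms as subroutines. `alg A k e` puts the
output of `A` on input `e` into register `k`. The only loop is `iter p`, which runs `p` as often as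
the length of a clock that programs cannot access, so that a program always halts in polynomial
time. -/
inductive Prog : Type
  | assign : ℕ → Expr → Prog
  | alg : Alg → ℕ → Expr → Prog
  | call : ℕ → Prog
  | seq : Prog → Prog → Prog
  | cond : Expr → Prog → Prog → Prog
  | iter : Prog → Prog

namespace Prog

/-- `L` repetitions of a randomized action on registers and the state of a party. -/
noncomputable def repeated {σ : Type} (f : Store → σ → PMF (Store × σ)) :
    ℕ → Store → σ → PMF (Store × σ)
  | 0 => fun w x => PMF.pure (w, x)
  | L + 1 => fun w x => (f w x).bind fun r => repeated f L r.1 r.2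

/-- What a program does to its registers, on security parameter `n` and with a clock of length
`L`, interacting with the party `O`. -/
noncomputable def denote {σ : Type} (O : Party σ) (n L : ℕ) : Prog → Store → σ → PMF (Store × σ)
  | .assign k e => fun w x => PMF.pure (Function.update w k (e.eval w), x)
  | .alg A k e => fun w x => (A.run n (e.eval w)).map fun d => (Function.update w k d, x)
  | .call k => fun w x => (O x (w k)).map fun a => (Function.update w k a.2, a.1)
  | .seq p q => fun w x => (p.denote O n L w x).bind fun r => q.denote O n L r.1 r.2
  | .cond e p q => fun w x => if e.eval w = .nil then q.denote O n L w x else p.denote O n L w x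
  | .iter p => repeated (p.denote O n L) L

/-- Sets the registers `2, 6, …, 4 * N - 2` to `nil` (and register `2` in any case). -/
def clear : ℕ → Cmd
  | 0 => .assign 2 .nil
  | N + 1 => .seq (clear N) (.assign (4 * N + 2) .nil)

/-- The translation of programs to commands. Register `k` of the program is register `4 * k`, and
algorithms that are called as subroutines use the registers `4 * i + 2`. The registers `4 * i + 1` are
left alone. Register `3` holds the clock, register `7` a stack of counters, and register `11` the
security parameter. Calls inside of a subroutine are answered by `nil`. -/
noncomputable def compile : Prog → Cmd
  | .assign k e => .assign (4 * k) (e.rename (4 * ·))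
  | .alg A k e =>
      .seq (clear A.code.exists_below.choose)
        (.seq (.assign 2 (.cons (.reg 11) (e.rename (4 * ·))))
          (.seq (A.code.inline (4 * · + 2) fun x => .assign (4 * x + 2) .nil)
            (.assign (4 * k) (.reg 2))))
  | .call k => .call (4 * k)
  | .seq p q => .seq p.compile q.compile
  | .cond e p q => .cond (e.rename (4 * ·)) p.compile q.compile
  | .iter p =>
      .seq (.assign 7 (.cons (.reg 3) (.reg 7)))
        (.seq
          (.loop (.hd (.reg 7))
            (.seq (.assign 7 (.cons (.tl (.hd (.reg 7))) (.tl (.reg 7)))) p.compile))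
          (.assign 7 (.tl (.reg 7))))

/-- A bound on the running time of a compiled program if the length of the clock is bounded by
`M`. -/
noncomputable def time (M : Polynomial ℕ) : Prog → Polynomial ℕ
  | .assign _ _ => 1
  | .alg A _ _ => A.time + 2 * Polynomial.C A.code.exists_below.choose + 6
  | .call _ => 1
  | .seq p q => 1 + p.time M + q.time M
  | .cond _ p q => 1 + (p.time M + q.time M)
  | .iter p => M * (p.time M + 3) + 5

theorem eval_rename_four {s w : Store} (h : ∀ k, s (4 * k) = w k) (e : Expr) :
    (e.rename (4 * ·)).eval s = e.eval w := by
  obtain ⟨N, hN⟩ := e.exists_below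
  exact Expr.eval_rename (fun i _ => h i) hN

variable {σ : Type} {O : Party σ}

theorem clear_implements (N : ℕ) (s : Store) :
    Implements O (clear N) s (2 * N + 1)
      (fun (_ : Unit) s' => (∀ i < N, s' (4 * i + 2) = .nil) ∧ s' 2 = .nil ∧
        ∀ r, r % 4 ≠ 2 → s' r = s r) fun x => PMF.pure ((), x) := by
  induction N generalizing s with
  | zero =>
    refine .assign _ _ _ ⟨by simp, by simp [Expr.eval], fun r hr => ?_⟩
    rw [Function.update_of_ne]; rintro rfl; omega
  | succ N ih =>
    refine (ih s).assign_after ?_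
    rintro _ s' ⟨h₁, h₂, h₃⟩
    refine ⟨fun i hi => ?_, ?_, fun r hr => ?_⟩
    · rw [Function.update_apply]
      split_ifs with h
      · rfl
      · exact h₁ i (by omega)
    · rw [Function.update_apply, h₂]
      split_ifs <;> rfl
    · rw [Function.update_of_ne (by rintro rfl; omega), h₃ r hr]

theorem inline_alg_implements (A : Alg) (n : ℕ) (d : Data) (s : Store)
    (hs : ∀ i < max A.code.exists_below.choose 1,
      s (4 * i + 2) = (A.code.start (.cons (.num n) d)).store i) :
    Implements O (A.code.inline (4 * · + 2) fun x => .assign (4 * x + 2) .nil) s (A.time.eval n)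
      (fun (out : Data) s' => s' 2 = out ∧ ∀ r, r % 4 ≠ 2 → s' r = s r)
      fun x => (A.run n d).map fun out => (out, x) := by
  intro k t' g hg
  obtain ⟨h₁, h₂⟩ := inline_implements (O := O) (ω := Unit) (O' := fun y _ => PMF.pure (y, .nil))
    (ρ := (4 * · + 2)) (fun i j h => by simpa using h) (N := max A.code.exists_below.choose 1)
    (h := 1) le_rfl (H := fun x => .assign (4 * x + 2) .nil)
    (Inv := fun _ _ s' => ∀ r, r % 4 ≠ 2 → s' r = s r)
    (fun _ _ s' i d h r hr => by rw [Function.update_of_ne (by rintro rfl; omega), h r hr])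
    (fun _ _ _ => id)
    (fun _ _ s' x h => by
      simp only [PMF.pure_map]
      refine .assign _ _ _ ⟨fun r hr => ?_, ?_, fun i hi => ?_⟩
      · rw [Function.update_of_ne (by rintro rfl; omega), h r hr]
      · rw [Function.update_self]; rfl
      · exact Function.update_of_ne (by omega) _ _)
    (A.time.eval n) [A.code] (A.code.start (.cons (.num n) d)).store () s
    (A.halts n d (Set.mem_univ d))
    (by simpa using A.code.exists_below.choose_spec.mono (le_max_left _ _))
    (fun _ _ => rfl) hs k t' (fun v _ => g (v 0))
    (fun v' _ s' h h' => hg _ _ ⟨h' 0 (by simp), h⟩)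
  rw [Nat.one_mul] at h₁ h₂
  refine ⟨h₁, fun x => (h₂ x).trans ?_⟩
  beta_reduce
  rw [Alg.run, PPT.interact, PMF.map_comp, PMF.bind_map]
  refine Couples.steps (R := fun y _ => y = ((), x)) ?_ _ _ rfl _ _ _ ?_
  · rintro _ _ q rfl
    exact .pure ⟨rfl, rfl⟩
  · rintro ⟨c₁, y₁⟩ ⟨c₂, y₂⟩ ⟨h₃, h₄⟩
    obtain rfl : c₁ = c₂ := h₃
    obtain rfl : y₁ = ((), x) := h₄
    rfl

/-- The registers outside of the program and its subroutines are preserved, and the program's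
registers are described by `w'`. -/
def Frame (s : Store) (w' s' : Store) : Prop :=
  (∀ k, s' (4 * k) = w' k) ∧ ∀ r, r % 4 = 1 ∨ r % 4 = 3 → s' r = s r

theorem Frame.trans {s s' s'' w' w'' : Store} (h : Frame s w' s') (h' : Frame s' w'' s'') :
    Frame s w'' s'' :=
  ⟨h'.1, fun r hr => (h'.2 r hr).trans (h.2 r hr)⟩

/-- Compiled programs do what `denote` says, within `time M`, whatever is in their registers. -/
theorem compile_implements (n : ℕ) (M : Polynomial ℕ) (p : Prog) (w s : Store)
    (hw : ∀ k, s (4 * k) = w k) (hn : s 11 = .num n) (hM : (s 3).toNat ≤ M.eval n) :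
    Implements O p.compile s ((p.time M).eval n) (Frame s) (p.denote O n (s 3).toNat w) := by
  induction p generalizing w s with
  | assign k e =>
    simp only [time, Polynomial.eval_one]
    refine .assign _ _ _ ⟨fun j => ?_, fun r hr => ?_⟩
    · rw [eval_rename_four hw, Function.update_apply, Function.update_apply, hw]
      simp
    · rw [Function.update_of_ne (by rintro rfl; omega)]
  | call k =>
    simp only [time, Polynomial.eval_one]
    have := (Implements.call (O := O) (4 * k) s (Rel := fun a s' => s' = Function.update s (4 * k) a)
      fun _ => rfl).map (R₂ := Frame s) (Function.update w k) ?_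
    · simpa only [denote, compile, PMF.map_comp, Function.comp_def, hw] using this
    · rintro a _ rfl
      refine ⟨fun j => ?_, fun r hr => ?_⟩
      · rw [Function.update_apply, Function.update_apply, hw]
        simp
      · rw [Function.update_of_ne (by rintro rfl; omega)]
  | alg A k e =>
    have h₁ := (inline_alg_implements A n (e.eval w) (O := O))
    have h₂ := (clear_implements (O := O) A.code.exists_below.choose s).seq_pure (t₂ := 2 + _)
      (R₂ := fun (d : Data) s' => Frame s (Function.update w k d) s')
      (b := .seq (.assign 2 (.cons (.reg 11) (e.rename (4 * ·))))
          (.seq (A.code.inline (4 * · + 2) fun x => .assign (4 * x + 2) .nil)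
            (.assign (4 * k) (.reg 2)))) (μ := fun x => (A.run n (e.eval w)).map fun d => (d, x))
      fun s' hs' => .seq_assign <| (h₁ _ ?_).assign_after ?_
    · have h₃ := h₂.map (R₂ := Frame s) (Function.update w k) fun _ _ => id
      simp only [PMF.map_comp, Function.comp_def] at h₃
      refine h₃.mono ?_ fun _ _ => id
      simp only [time, Polynomial.eval_add, Polynomial.eval_mul, Polynomial.eval_ofNat,
        Polynomial.eval_C]
      omega
    · obtain ⟨h₃, h₄, h₅⟩ := hs'
      have h₆ : (Expr.cons (.reg 11) (e.rename (4 * ·))).eval s' = .cons (.num n) (e.eval w) := by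
        simp only [Expr.eval]
        rw [eval_rename_four fun k => by rw [h₅ _ (by omega), hw], h₅ 11 (by omega), hn]
      intro i hi
      rw [h₆]
      by_cases hi0 : i = 0
      · subst hi0; rfl
      · rw [Function.update_of_ne (by omega), h₃ i (by omega)]
        simp [Cmd.start, hi0]
    · rintro d s'' ⟨h₃, h₄⟩
      have h₅ : ∀ r, r % 4 ≠ 2 → s'' r = s r := fun r hr => by
        rw [h₄ r hr, Function.update_of_ne (by rintro rfl; omega), hs'.2.2 r hr]
      refine ⟨fun j => ?_, fun r hr => ?_⟩
      · rw [Function.update_apply, Function.update_apply, h₅ _ (by omega), hw]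
        simp [Expr.eval, h₃]
      · rw [Function.update_of_ne (by rintro rfl; omega), h₅ r (by omega)]
  | seq p q ihp ihq =>
    simp only [time, Polynomial.eval_add, Polynomial.eval_one]
    refine (ihp w s hw hn hM).seq fun w' s' h => ?_
    have e3 : s' 3 = s 3 := h.2 3 (by omega)
    have := ihq w' s' h.1 (by rw [h.2 11 (by omega), hn]) (by rwa [e3])
    rw [e3] at this
    exact this.mono le_rfl fun _ _ => h.trans
  | cond e p q ihp ihq =>
    simp only [time, Polynomial.eval_add, Polynomial.eval_one]
    refine .cond ?_
    rw [eval_rename_four hw]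
    unfold denote
    split_ifs
    · exact (ihq w s hw hn hM).mono (by omega) fun _ _ => id
    · exact (ihp w s hw hn hM).mono (by omega) fun _ _ => id
  | iter p ih =>
    have loop : ∀ (L : ℕ) (w s₁ : Store), (∀ k, s₁ (4 * k) = w k) →
        (∀ r, r ≠ 7 → r % 4 = 1 ∨ r % 4 = 3 → s₁ r = s r) →
        (s₁ 7).tl = s 7 → (s₁ 7).hd.toNat = L →
        Implements O (.loop (.hd (.reg 7))
            (.seq (.assign 7 (.cons (.tl (.hd (.reg 7))) (.tl (.reg 7)))) p.compile)) s₁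
          (L * ((p.time M).eval n + 3) + 1)
          (fun w' s' => (∀ k, s' (4 * k) = w' k) ∧
            (∀ r, r ≠ 7 → r % 4 = 1 ∨ r % 4 = 3 → s' r = s r) ∧ (s' 7).tl = s 7)
          (repeated (p.denote O n (s 3).toNat) L w) := by
      intro L
      induction L with
      | zero =>
        intro w s₁ h₁ h₂ h₃ h₄
        rw [Nat.zero_mul]
        exact .loop_nil (Data.toNat_eq_zero.1 h₄) ⟨h₁, h₂, h₃⟩
      | succ L ihL =>
        intro w s₁ h₁ h₂ h₃ h₄
        have hne : (Expr.hd (.reg 7)).eval s₁ ≠ .nil := by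
          intro h0
          have : (s₁ 7).hd.toNat = 0 := Data.toNat_eq_zero.2 h0
          omega
        have hs : ∀ r, r ≠ 7 → Function.update s₁ 7 (.cons (s₁ 7).hd.tl (s₁ 7).tl) r = s₁ r :=
          fun r hr => Function.update_of_ne hr _ _
        have body := ih w (Function.update s₁ 7 (.cons (s₁ 7).hd.tl (s₁ 7).tl))
          (fun k => by rw [hs _ (by omega), h₁]) (by rw [hs _ (by omega), h₂ _ (by omega) (by omega), hn])
          (by rw [hs _ (by omega), h₂ _ (by omega) (by omega)]; exact hM)
        rw [hs 3 (by omega), h₂ 3 (by omega) (by omega)] at body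
        refine ((Implements.loop_cons hne (.seq_assign body) (t₂ := L * ((p.time M).eval n + 3) + 1)
          (ν := repeated (p.denote O n (s 3).toNat) L) ?_).mono ?_ fun _ _ => id)
        · rintro w' s' ⟨h₅, h₆⟩
          have h7 := h₆ 7 (by omega)
          rw [Function.update_self] at h7
          refine ihL w' s' h₅ (fun r hr hr' => ?_) ?_ ?_
          · rw [h₆ r hr', hs r hr, h₂ r hr hr']
          · rw [h7, ← h₃]; rfl
          · rw [h7]
            change (s₁ 7).hd.tl.toNat = L
            rw [Data.toNat_tl, h₄]; rfl
        · rw [Nat.add_mul]; omega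
    have h := loop (s 3).toNat w (Function.update s 7 (.cons (s 3) (s 7)))
      (fun k => by rw [Function.update_of_ne (by omega), hw])
      (fun r hr _ => Function.update_of_ne hr _ _) (by rw [Function.update_self]; rfl)
      (by rw [Function.update_self]; rfl)
    have h' := Implements.seq_assign (r := 7) (e := .cons (.reg 3) (.reg 7)) <|
      h.assign_after (r := 7) (e := .tl (.reg 7)) (R₂ := Frame s) ?_
    · refine h'.mono ?_ fun _ _ => id
      simp only [time, Polynomial.eval_add, Polynomial.eval_mul, Polynomial.eval_ofNat]
      have := Nat.mul_le_mul_right ((p.time M).eval n + 3) hM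
      omega
    · rintro w' s' ⟨h₁, h₂, h₃⟩
      refine ⟨fun k => by rw [Function.update_of_ne (by omega), h₁], fun r hr => ?_⟩
      rw [Function.update_apply]
      split_ifs with hr7
      · rw [hr7]; exact h₃
      · exact h₂ r hr7 hr

end Prog

/-! ### Reductions -/

namespace Prog

variable {σ : Type}

/-- The party that answers messages by running a program. Its state consists of the program's
registers, the length of the clock, and the state of the party `O` that the program calls. The
message is put into register `7`, where the answer is found afterwards. Before each run the clock is
advanced by two, so that lists to which a run adds at most two elements stay shorter than the
clock. -/
noncomputable def party (p : Prog) (O : Party σ) (n : ℕ) : Party ((Store × ℕ) × σ) := fun y q =>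
  (p.denote O n (y.1.2 + 2) (Function.update y.1.1 7 q) y.2).map fun r =>
    (((r.1, y.1.2 + 2), r.2), r.1 7)

/-- The code that answers the message in register `4 * x + 1` by means of `p`. -/
noncomputable def handler (p : Prog) (x : ℕ) : Cmd :=
  .seq (.assign 3 (.cons .nil (.cons .nil (.reg 3))))
    (.seq (.assign 28 (.reg (4 * x + 1)))
      (.seq p.compile (.assign (4 * x + 1) (.reg 28))))

/-- The code of a machine that runs `c` and answers its messages by means of `p`. The registers of
`c` are shifted to `4 * i + 1`. At first the clock is the second half of the input, a copy of which
is also given to the program in its register `6`. -/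
noncomputable def wrap (p : Prog) (c : Cmd) : Cmd :=
  .seq (.assign 11 (.hd (.reg 0)))
    (.seq (.assign 3 (.tl (.reg 0)))
      (.seq (.assign 24 (.tl (.reg 0)))
        (.seq (.assign 1 (.reg 0))
          (.seq (c.inline (4 * · + 1) p.handler) (.assign 0 (.reg 1))))))

/-- The initial contents of the registers of a program inside of `wrap`, on input `1ⁿ`, `1ᵐ`. -/
def initStore (n m : ℕ) : Store :=
  Function.update (Function.update (fun _ => .nil) 0 (.cons (.num n) (.num m))) 6 (.num m)

theorem handler_implements {O : Party σ} (p : Prog) {n b : ℕ} {M : Polynomial ℕ} {w : Store × ℕ}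
    {s : Store} (x : ℕ) (hs : (∀ k, s (4 * k) = w.1 k) ∧ s 11 = .num n ∧ (s 3).toNat = w.2 ∧
      w.2 + 2 * (b + 1) ≤ M.eval n) :
    Implements O (p.handler x) s ((p.time M).eval n + 6)
      (fun (r : (Store × ℕ) × Data) s' => ((∀ k, s' (4 * k) = r.1.1 k) ∧ s' 11 = .num n ∧
        (s' 3).toNat = r.1.2 ∧ r.1.2 + 2 * b ≤ M.eval n) ∧ s' (4 * x + 1) = r.2 ∧
        ∀ i, i ≠ x → s' (4 * i + 1) = s (4 * i + 1))
      fun y => (p.party O n (w, y) (s (4 * x + 1))).map fun r => ((r.1.1, r.2), r.1.2) := by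
  obtain ⟨hw, hn, h3, hM⟩ := hs
  have hclk : (Data.cons .nil (.cons .nil (s 3))).toNat = w.2 + 2 := by
    rw [← h3]; rfl
  have h := compile_implements (O := O) n M p (Function.update w.1 7 (s (4 * x + 1)))
    (Function.update (Function.update s 3 (.cons .nil (.cons .nil (s 3)))) 28 (s (4 * x + 1)))
    (fun k => by
      rw [Function.update_apply, Function.update_of_ne (by omega), hw]
      by_cases hk : k = 7
      · simp [hk]
      · rw [if_neg (by omega), Function.update_of_ne hk])
    (by rw [Function.update_of_ne (by omega), Function.update_of_ne (by omega), hn])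
    (by rw [Function.update_of_ne (by omega), Function.update_self, hclk]
        omega)
  rw [Function.update_of_ne (by omega : 3 ≠ 28), Function.update_self, hclk] at h
  have h' := (h.map (R₂ := fun (r : (Store × ℕ) × Data) s' => Frame _ r.1.1 s' ∧
    r.1.2 = w.2 + 2 ∧ r.2 = r.1.1 7) (fun w' => ((w', w.2 + 2), w' 7))
    fun w' s' hs => ⟨hs, rfl, rfl⟩)
  have h'' := Implements.seq_assign (r := 3) (e := .cons .nil (.cons .nil (.reg 3))) <|
    Implements.seq_assign (r := 28) (e := .reg (4 * x + 1)) <|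
    Implements.assign_after (r := 4 * x + 1) (e := .reg 28) (c := p.compile)
      (by
        simp only [Expr.eval]
        rw [Function.update_of_ne (by omega : 4 * x + 1 ≠ 3)]
        exact h')
      (R₂ := fun (r : (Store × ℕ) × Data) s' => ((∀ k, s' (4 * k) = r.1.1 k) ∧ s' 11 = .num n ∧
        (s' 3).toNat = r.1.2 ∧ r.1.2 + 2 * b ≤ M.eval n) ∧ s' (4 * x + 1) = r.2 ∧
        ∀ i, i ≠ x → s' (4 * i + 1) = s (4 * i + 1))
      ?_
  · refine Implements.mono (R₁ := _) ?_ (by omega : 2 + (2 + ((p.time M).eval n + 2)) ≤ _)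
      fun _ _ => id
    simpa only [handler, party, PMF.map_comp, Function.comp_def] using h''
  · rintro ⟨⟨w', L⟩, d⟩ s' ⟨⟨h₁, h₂⟩, hL, hd⟩
    obtain rfl : L = w.2 + 2 := hL
    obtain rfl : d = w' 7 := hd
    have h₃ : ∀ r, r % 4 = 1 ∨ r % 4 = 3 → r ≠ 3 → s' r = s r := fun r hr hr3 => by
      rw [h₂ r hr, Function.update_of_ne (by rintro rfl; omega), Function.update_of_ne hr3]
    refine ⟨⟨fun k => ?_, ?_, ?_, ?_⟩, ?_, fun i hi => ?_⟩
    · rw [Function.update_of_ne (by omega), h₁]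
    · rw [Function.update_of_ne (by omega), h₃ 11 (by omega) (by omega), hn]
    · rw [Function.update_of_ne (by omega), h₂ 3 (by omega), Function.update_of_ne (by omega),
        Function.update_self, hclk]
    · change w.2 + 2 + 2 * b ≤ _
      omega
    · rw [Function.update_self]
      exact h₁ 7
    · rw [Function.update_of_ne (by omega), h₃ _ (by omega) (by omega)]

/-- `wrap` runs the machine in interaction with `Prog.party`. The polynomial `q + 2 * A.time` bounds
the length of the clock, because there are at most `A.time` calls. -/
theorem wrap_implements {Inp : ℕ → Set Data} (A : PPT Inp) (p : Prog) (O : Party σ)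
    (q : Polynomial ℕ) {n m : ℕ} (hm : m ≤ q.eval n) (hA : Data.num m ∈ Inp n) :
    Implements O (p.wrap A.code)
      (Function.update (fun _ => Data.nil) 0 (.cons (.num n) (.num m)))
      ((((p.time (q + 2 * A.time)) + 6) * A.time + 10).eval n)
      (fun out s' => s' 0 = out)
      fun x => (steps (p.party O n) (A.time.eval n)
        (A.code.start (.cons (.num n) (.num m)), ((initStore n m, m), x))).map
          fun r => (r.1.store 0, r.2.2) := by
  obtain ⟨N, hN⟩ := A.code.exists_below
  have main : ∀ s : Store, s = Function.update (Function.update (Function.update (Function.update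
      (Function.update (fun _ => Data.nil) 0 (.cons (.num n) (.num m))) 11 (.num n)) 3 (.num m))
      24 (.num m)) 1 (.cons (.num n) (.num m)) →
      Implements O (A.code.inline (4 * · + 1) p.handler) s
        (((p.time (q + 2 * A.time)).eval n + 6) * A.time.eval n)
        (fun out s' => s' 1 = out)
        fun x => (steps (p.party O n) (A.time.eval n)
          (A.code.start (.cons (.num n) (.num m)), ((initStore n m, m), x))).map
            fun r => (r.1.store 0, r.2.2) := by
    rintro s rfl k t' g hg
    obtain ⟨h₁, h₂⟩ := inline_implements (O := O) (O' := p.party O n) (ρ := (4 * · + 1))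
      (fun i j h => by simpa using h) (N := max N 1) (h := (p.time (q + 2 * A.time)).eval n + 6)
      (by omega) (H := p.handler)
      (Inv := fun b w s => (∀ k, s (4 * k) = w.1 k) ∧ s 11 = .num n ∧ (s 3).toNat = w.2 ∧
        w.2 + 2 * b ≤ (q + 2 * A.time).eval n)
      (fun b w s i d h => by
        refine ⟨fun k => ?_, ?_, ?_, h.2.2.2⟩
        · rw [Function.update_of_ne (by omega), h.1]
        · rw [Function.update_of_ne (by omega), h.2.1]
        · rw [Function.update_of_ne (by omega), h.2.2.1])
      (fun b w s h => ⟨h.1, h.2.1, h.2.2.1, by have := h.2.2.2; omega⟩)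
      (fun b w s x h => p.handler_implements x h)
      (A.time.eval n) [A.code] (A.code.start (.cons (.num n) (.num m))).store
      (initStore n m, m)
      (Function.update (Function.update (Function.update (Function.update
      (Function.update (fun _ => Data.nil) 0 (.cons (.num n) (.num m))) 11 (.num n)) 3 (.num m))
      24 (.num m)) 1 (.cons (.num n) (.num m)))
      (A.halts n _ hA) (by simpa using hN.mono (le_max_left N 1))
      (by
        refine ⟨fun k => ?_, ?_, ?_, ?_⟩
        · simp only [initStore, Function.update_apply]
          split_ifs <;> first | rfl | omega
        · simp
        · simp [Data.toNat_num]
        · simp only [Polynomial.eval_add, Polynomial.eval_mul, Polynomial.eval_ofNat]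
          omega)
      (fun i _ => by
        simp only [Cmd.start, Function.update_apply]
        split_ifs <;> first | rfl | omega)
      k t' (fun v _ => g (v 0)) (fun v' _ s' _ h' => hg _ _ (h' 0 (by simp)))
    refine ⟨h₁, fun x => (h₂ x).trans ?_⟩
    rw [PMF.bind_map]
    rfl
  refine Implements.mono (.seq_assign <| .seq_assign <| .seq_assign <| .seq_assign <|
    (main _ rfl).assign_after fun a s' h => ?_) ?_ fun _ _ => id
  · rw [Function.update_self]; exact h
  · simp only [Polynomial.eval_add, Polynomial.eval_mul, Polynomial.eval_ofNat]
    omega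

/-- The machine that runs the adversary `A` against the party that is played by the program `p`. -/
noncomputable def reduction {m : ℕ → ℕ} (p : Prog) (A : PPT fun n => {Data.num (m n)})
    (q : Polynomial ℕ) (hq : ∀ n, m n ≤ q.eval n) : PPT fun n => {Data.num (m n)} where
  code := p.wrap A.code
  time := (p.time (q + 2 * A.time) + 6) * A.time + 10
  halts := by
    rintro n _ rfl
    exact (p.wrap_implements A (fun (x : Unit) _ => PMF.pure (x, .nil)) q (hq n) rfl [] 0
      (fun out _ => PMF.pure out) fun a s' h => ⟨rfl, fun x => by
        simp [obs, steps, PMF.pure_map, h]⟩).1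

theorem reduction_interact {m : ℕ → ℕ} (p : Prog) (A : PPT fun n => {Data.num (m n)})
    (q : Polynomial ℕ) (hq : ∀ n, m n ≤ q.eval n) (O : Party σ) (x : σ) (n : ℕ) :
    (p.reduction A q hq).interact O x n (.num (m n)) =
      A.interact (p.party O n) ((initStore n (m n), m n), x) n (.num (m n)) := by
  refine ((p.wrap_implements A O q (hq n) rfl [] 0
      (fun out _ => PMF.pure out) fun a s' h => ⟨rfl, fun x => by
        simp [obs, steps, PMF.pure_map, h]⟩).2 x).trans ?_
  rw [PMF.bind_map]
  rfl

end Prog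

/-! ### List operations -/

namespace Prog

variable {σ : Type} (O : Party σ) (n : ℕ)

/-- The program that does nothing. -/
def skip : Prog := .assign 8 (.reg 8)

theorem denote_skip (L : ℕ) (w : Store) (x : σ) : skip.denote O n L w x = PMF.pure (w, x) := by
  simp [skip, denote, Expr.eval]

/-- Moves an element of the list in register `9` to the list in register `10`, while the unary
number in register `8` is counted down. -/
def seekBody : Prog :=
  .cond (.reg 8) (.cond (.reg 9)
    (.seq (.assign 10 (.cons (.hd (.reg 9)) (.reg 10)))
      (.seq (.assign 9 (.tl (.reg 9))) (.assign 8 (.tl (.reg 8))))) skip) skip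

/-- Moves an element of the list in register `10` back to the list in register `9`. -/
def rewindBody : Prog :=
  .cond (.reg 10)
    (.seq (.assign 9 (.cons (.hd (.reg 10)) (.reg 9))) (.assign 10 (.tl (.reg 10)))) skip

/-- Splits the list in register `l` at position `i`: register `9` is the rest of the list from there
on, and register `10` is the beginning of the list in reverse order. Register `8` is what is left of
the number, if it exceeds the length of the list. -/
def find (l : ℕ) (i : Expr) : Prog :=
  .seq (.assign 8 i) (.seq (.assign 9 (.reg l)) (.seq (.assign 10 .nil) (.iter seekBody)))

/-- Puts the list that `find` has split together again. -/
def rewind : Prog := .iter rewindBody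

/-- Appends an element to the list in register `l`. -/
def push (l : ℕ) (e : Expr) : Prog :=
  .seq (.assign 15 e)
    (.seq (find l (.reg l))
      (.seq (.assign 9 (.cons (.reg 15) (.reg 9))) (.seq rewind (.assign l (.reg 9)))))

/-- Runs `p` if `e` is not `nil`, and answers `nil` otherwise. -/
def require (e : Expr) (p : Prog) : Prog := .cond e p (.assign 7 .nil)

/-- Runs the program in the list `ps` whose position is the unary number `e`, or `q` if there is no
such position. -/
def dispatch (e : Expr) (q : Prog) : List Prog → Prog
  | [] => q
  | p :: ps => .cond e (dispatch (.tl e) q ps) p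

theorem denote_dispatch (L : ℕ) (q : Prog)
    (ps : List Prog) (e : Expr) (w : Store) (x : σ) :
    (dispatch e q ps).denote O n L w x = (ps.getD (e.eval w).toNat q).denote O n L w x := by
  induction ps generalizing e with
  | nil => rfl
  | cons p ps ih =>
    simp only [dispatch, denote, ih]
    rcases he : e.eval w with _ | ⟨a, b⟩
    · rfl
    · simp [Expr.eval, he, Data.toNat]

theorem repeated_of_fixed {f : Store → σ → PMF (Store × σ)} {w : Store}
    (h : ∀ x, f w x = PMF.pure (w, x)) (L : ℕ) (x : σ) : repeated f L w x = PMF.pure (w, x) := by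
  induction L with
  | zero => rfl
  | succ L ih => simp only [repeated, h, PMF.pure_bind, ih]

theorem seek_spec (M L : ℕ) (w : Store) (h : (w 9).toNat ≤ L ∨ (w 8).toNat ≤ L) :
    ∃ w', (∀ x, repeated (seekBody.denote O n M) L w x = PMF.pure (w', x)) ∧
      (∀ k, k ≠ 8 → k ≠ 9 → k ≠ 10 → w' k = w k) ∧
      (w' 8).toList = (w 8).toList.drop (w 9).toNat ∧
      (w' 9).toList = (w 9).toList.drop (w 8).toNat ∧
      (w' 10).toList = ((w 9).toList.take (w 8).toNat).reverse ++ (w 10).toList := by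
  induction L generalizing w with
  | zero =>
    refine ⟨w, fun x => rfl, fun _ _ _ _ => rfl, ?_⟩
    simp only [Nat.le_zero, Data.toNat_eq_zero] at h
    rcases h with h | h <;> simp [h, Data.toNat]
  | succ L ih =>
    rcases h8 : w 8 with _ | ⟨a, i⟩
    · refine ⟨w, repeated_of_fixed (fun x => ?_) _, fun _ _ _ _ => rfl, ?_⟩
      · simp [seekBody, denote, Expr.eval, h8, denote_skip]
      · simp [h8, Data.toNat, Data.toList]
    rcases h9 : w 9 with _ | ⟨b, l⟩
    · refine ⟨w, repeated_of_fixed (fun x => ?_) _, fun _ _ _ _ => rfl, ?_⟩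
      · simp [seekBody, denote, Expr.eval, h8, h9, denote_skip]
      · simp [h8, h9, Data.toNat, Data.toList]
    obtain ⟨w', h₁, h₂, h₃, h₄, h₅⟩ := ih (Function.update (Function.update
      (Function.update w 10 (.cons b (w 10))) 9 l) 8 i) (by
        simpa [h8, h9, Data.toNat, Data.toList] using h)
    refine ⟨w', fun x => ?_, fun k hk₁ hk₂ hk₃ => ?_, ?_, ?_, ?_⟩
    · rw [repeated, ← h₁]
      simp [seekBody, denote, Expr.eval, h8, h9, PMF.pure_bind, Data.hd, Data.tl]
    · rw [h₂ k hk₁ hk₂ hk₃]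
      simp [hk₁, hk₂, hk₃]
    · simpa [Data.toNat, Data.toList] using h₃
    · simpa [Data.toNat, Data.toList] using h₄
    · simpa [Data.toNat, Data.toList] using h₅

theorem rewind_spec (M L : ℕ) (w : Store) (h : (w 10).toNat ≤ L) :
    ∃ w', (∀ x, repeated (rewindBody.denote O n M) L w x = PMF.pure (w', x)) ∧
      (∀ k, k ≠ 9 → k ≠ 10 → w' k = w k) ∧
      (w' 9).toList = (w 10).toList.reverse ++ (w 9).toList := by
  induction L generalizing w with
  | zero =>
    refine ⟨w, fun x => rfl, fun _ _ _ => rfl, ?_⟩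
    simp only [Nat.le_zero, Data.toNat_eq_zero] at h
    simp [h]
  | succ L ih =>
    rcases h10 : w 10 with _ | ⟨a, p⟩
    · refine ⟨w, repeated_of_fixed (fun x => ?_) _, fun _ _ _ => rfl, ?_⟩
      · simp [rewindBody, denote, Expr.eval, h10, denote_skip]
      · simp [Data.toList]
    obtain ⟨w', h₁, h₂, h₃⟩ := ih (Function.update (Function.update w 9 (.cons a (w 9))) 10 p) (by
        simpa [h10, Data.toNat, Data.toList] using h)
    refine ⟨w', fun x => ?_, fun k hk₁ hk₂ => ?_, ?_⟩
    · rw [repeated, ← h₁]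
      simp [rewindBody, denote, Expr.eval, h10, PMF.pure_bind, Data.hd, Data.tl]
    · rw [h₂ k hk₁ hk₂]
      simp [hk₁, hk₂]
    · simpa [Data.toList] using h₃

theorem denote_rewind {L : ℕ} {w : Store} (h : (w 10).toNat ≤ L) :
    ∃ w', (∀ x, rewind.denote O n L w x = PMF.pure (w', x)) ∧
      (∀ k, k ≠ 9 → k ≠ 10 → w' k = w k) ∧
      (w' 9).toList = (w 10).toList.reverse ++ (w 9).toList :=
  rewind_spec O n L L w h

theorem denote_find {L l : ℕ} {i : Expr} {w : Store} (hl : l ≠ 8)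
    (h : (w l).toNat ≤ L ∨ (i.eval w).toNat ≤ L) :
    ∃ w', (∀ x, (find l i).denote O n L w x = PMF.pure (w', x)) ∧
      (∀ k, k ≠ 8 → k ≠ 9 → k ≠ 10 → w' k = w k) ∧
      (w' 8).toList = (i.eval w).toList.drop (w l).toNat ∧
      (w' 9).toList = (w l).toList.drop (i.eval w).toNat ∧
      (w' 10).toList = ((w l).toList.take (i.eval w).toNat).reverse := by
  obtain ⟨w', h₁, h₂, h₃, h₄, h₅⟩ := seek_spec O n L L (Function.update (Function.update
    (Function.update w 8 (i.eval w)) 9 (w l)) 10 .nil) (by simpa using h)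
  refine ⟨w', fun x => ?_, fun k hk₁ hk₂ hk₃ => ?_, ?_, ?_, ?_⟩
  · rw [← h₁]
    simp [find, denote, PMF.pure_bind, Expr.eval, hl]
  · rw [h₂ k hk₁ hk₂ hk₃]
    simp [hk₁, hk₂, hk₃]
  · simpa using h₃
  · simpa using h₄
  · simpa [Data.toList] using h₅

theorem denote_push {L l : ℕ} {e : Expr} {w : Store} (hl : l ≠ 8 ∧ l ≠ 9 ∧ l ≠ 10 ∧ l ≠ 15)
    (h : (w l).toNat ≤ L) :
    ∃ w', (∀ x, (push l e).denote O n L w x = PMF.pure (w', x)) ∧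
      (∀ k, k ≠ l → k ≠ 8 → k ≠ 9 → k ≠ 10 → k ≠ 15 → w' k = w k) ∧
      (w' l).toList = (w l).toList ++ [e.eval w] := by
  obtain ⟨w₁, h₁, h₂, _, h₄, h₅⟩ := denote_find O n (L := L) (l := l) (i := .reg l)
    (w := Function.update w 15 (e.eval w)) hl.1 (.inl (by simpa [hl.2.2.2] using h))
  simp only [Expr.eval, ne_eq, hl.2.2.2, not_false_eq_true, Function.update_of_ne] at h₄ h₅
  have h9 : (w₁ 9) = .nil := Data.toList_injective (by rw [h₄]; exact List.drop_length)
  have h10 : (w₁ 10).toList = (w l).toList.reverse := by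
    rw [h₅]; exact congrArg _ List.take_length
  obtain ⟨w₂, h₆, h₇, h₈⟩ := denote_rewind O n (L := L)
    (w := Function.update w₁ 9 (.cons (w₁ 15) (w₁ 9))) (by
      simpa [Data.toNat, h10] using h)
  refine ⟨Function.update w₂ l (w₂ 9), fun x => ?_, fun k hk₁ hk₂ hk₃ hk₄ hk₅ => ?_, ?_⟩
  · simp [push, denote, PMF.pure_bind, h₁, h₆, Expr.eval]
  · rw [Function.update_of_ne hk₁, h₇ k hk₃ hk₄, Function.update_of_ne hk₃, h₂ k hk₂ hk₃ hk₄,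
      Function.update_of_ne hk₅]
  · rw [Function.update_self, h₈]
    simp [h10, h9, Data.toList, h₂ 15]

end Prog

/-! ### The honest users, played by a program -/

/-- How the program stores a contact. -/
def Contact.encode (c : Contact) : Data := .cons c.peerKey c.secret

/-- How the program stores an OT session that it conducts itself. -/
def Request.encode (r : Request) : Data := .cons (.num r.session.choice) r.session.state

/-- The registers `w` of the program describe the state `st` of the honest users, where the
receiver in the OT game has the state `x`: registers `1` to `4` hold the key pairs, the contacts, the
directory and the OT sessions, register `5` records whether the challenge has taken place, and
register `6` holds `γ`. After the challenge, one of the sessions is that of the receiver in the OT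
game; it is represented by `nil`. A clock of length `L` suffices for all of the lists. -/
structure Related (P : AOT) (n L : ℕ) (w : Store) (x : Option Session) (st : Users) : Prop where
  users : (w 1).toList = st.users
  contacts : (w 2).toList = st.contacts.map Contact.encode
  directory : w 3 = st.directory
  challenged : w 5 = .ofBool st.challenged
  size : w 6 = .num (P.γ n)
  size_le : P.γ n ≤ L
  users_le : st.users.length ≤ L
  contacts_le : st.contacts.length ≤ L
  requests_le : st.requests.length ≤ L
  requests :
    (st.challenged = false ∧ x = none ∧ (w 4).toList = st.requests.map Request.encode) ∨
    (st.challenged = true ∧ ∃ r q, x = some q.session ∧ st.requests[r]? = some q ∧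
      (w 4).toList = (st.requests.map Request.encode).set r .nil)

namespace Related

variable {P : AOT} {n L : ℕ} {w w' : Store} {x : Option Session} {st : Users}

theorem congr (h : Related P n L w x st)
    (hw : w' 1 = w 1 ∧ w' 2 = w 2 ∧ w' 3 = w 3 ∧ w' 4 = w 4 ∧ w' 5 = w 5 ∧ w' 6 = w 6) :
    Related P n (L + 2) w' x st := by
  obtain ⟨h₁, h₂, h₃, h₄, h₅, h₆⟩ := hw
  exact ⟨h₁ ▸ h.users, h₂ ▸ h.contacts, h₃ ▸ h.directory, h₅ ▸ h.challenged, h₆ ▸ h.size,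
    h.size_le.trans (by omega), h.users_le.trans (by omega), h.contacts_le.trans (by omega),
    h.requests_le.trans (by omega), h₄ ▸ h.requests⟩

theorem addUser (h : Related P n L w x st) {keys : Data}
    (h₁ : (w' 1).toList = (w 1).toList ++ [keys])
    (hw : w' 2 = w 2 ∧ w' 3 = w 3 ∧ w' 4 = w 4 ∧ w' 5 = w 5 ∧ w' 6 = w 6) :
    Related P n (L + 2) w' x { st with users := st.users ++ [keys] } := by
  obtain ⟨h₂, h₃, h₄, h₅, h₆⟩ := hw
  have := h.users_le
  exact ⟨by rw [h₁, h.users], h₂ ▸ h.contacts, h₃ ▸ h.directory, h₅ ▸ h.challenged, h₆ ▸ h.size,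
    h.size_le.trans (by omega), by simp; omega, h.contacts_le.trans (by omega),
    h.requests_le.trans (by omega), h₄ ▸ h.requests⟩

theorem addContacts (h : Related P n L w x st) {cs : List Contact} (hcs : cs.length ≤ 2)
    (h₂ : (w' 2).toList = (w 2).toList ++ cs.map Contact.encode)
    (hw : w' 1 = w 1 ∧ w' 3 = w 3 ∧ w' 4 = w 4 ∧ w' 5 = w 5 ∧ w' 6 = w 6) :
    Related P n (L + 2) w' x { st with contacts := st.contacts ++ cs } := by
  obtain ⟨h₁, h₃, h₄, h₅, h₆⟩ := hw
  have := h.contacts_le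
  exact ⟨h₁ ▸ h.users, by rw [h₂, h.contacts, List.map_append], h₃ ▸ h.directory,
    h₅ ▸ h.challenged, h₆ ▸ h.size,
    h.size_le.trans (by omega), h.users_le.trans (by omega), by simp; omega,
    h.requests_le.trans (by omega), h₄ ▸ h.requests⟩

theorem setDirectory (h : Related P n L w x st)
    (hw : w' 1 = w 1 ∧ w' 2 = w 2 ∧ w' 4 = w 4 ∧ w' 5 = w 5 ∧ w' 6 = w 6) :
    Related P n (L + 2) w' x { st with directory := w' 3 } := by
  obtain ⟨h₁, h₂, h₄, h₅, h₆⟩ := hw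
  exact ⟨h₁ ▸ h.users, h₂ ▸ h.contacts, rfl, h₅ ▸ h.challenged, h₆ ▸ h.size,
    h.size_le.trans (by omega), h.users_le.trans (by omega), h.contacts_le.trans (by omega),
    h.requests_le.trans (by omega), h₄ ▸ h.requests⟩

theorem openRequest (h : Related P n L w x st) {u i : ℕ}
    (h₄ : (w' 4).toList = (w 4).toList ++ [.cons (.num i) .nil])
    (hw : w' 1 = w 1 ∧ w' 2 = w 2 ∧ w' 3 = w 3 ∧ w' 5 = w 5 ∧ w' 6 = w 6) :
    Related P n (L + 2) w' x (st.openRequest u i) := by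
  obtain ⟨h₁, h₂, h₃, h₅, h₆⟩ := hw
  have := h.requests_le
  refine ⟨h₁ ▸ h.users, h₂ ▸ h.contacts, h₃ ▸ h.directory, h₅ ▸ h.challenged, h₆ ▸ h.size,
    h.size_le.trans (by omega), h.users_le.trans (by omega), h.contacts_le.trans (by omega),
    by simp [Users.openRequest]; omega, ?_⟩
  rcases h.requests with ⟨h₇, h₈, h₉⟩ | ⟨h₇, r, q, h₈, h₉, h₁₀⟩
  · exact .inl ⟨h₇, h₈, by rw [h₄, h₉]; simp [Users.openRequest, Request.encode]⟩
  · have hr := (List.getElem?_eq_some_iff.1 h₉).1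
    refine .inr ⟨h₇, r, q, h₈, ?_, ?_⟩
    · simp only [Users.openRequest]
      rw [List.getElem?_append_left hr, h₉]
    · rw [h₄, h₁₀]
      simp only [Users.openRequest, List.map_append]
      rw [List.set_append_left _ _ (by simpa using hr)]
      rfl

theorem toNat_users (h : Related P n L w x st) : (w 1).toNat = st.users.length := by
  rw [Data.toNat, h.users]

theorem toNat_contacts (h : Related P n L w x st) : (w 2).toNat = st.contacts.length := by
  rw [Data.toNat, h.contacts, List.length_map]

theorem toNat_requests (h : Related P n L w x st) : (w 4).toNat = st.requests.length := by
  rw [Data.toNat]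
  rcases h.requests with ⟨_, _, h⟩ | ⟨_, _, _, _, _, h⟩ <;> simp [h]

/-- The receiver in the OT game has handled a message. -/
theorem setExternal {r : ℕ} {q : Request}
    (h : Related P n L w (some q.session) st) (hc : st.challenged = true)
    (hq : st.requests[r]? = some q)
    (hw : (w 4).toList = (st.requests.map Request.encode).set r .nil) (s : Session) :
    Related P n L w (some s) { st with requests := st.requests.set r ⟨q.user, s⟩ } := by
  refine { h with requests_le := by simpa using h.requests_le, requests := .inr ?_ }
  refine ⟨hc, r, ⟨q.user, s⟩, rfl, ?_, ?_⟩
  · simp [(List.getElem?_eq_some_iff.1 hq).1]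
  · rw [hw, List.map_set, List.set_set]

/-- A session that the program conducts has handled a message. -/
theorem setRequest {w' : Store} {r : ℕ} {q : Request} {e : Data}
    (h : Related P n L w x st) (hq : st.requests[r]? = some q) (he : (w 4).toList[r]? = some e)
    (hne : e ≠ .nil) (s : Session)
    (h₄ : (w' 4).toList = (w 4).toList.set r (Request.encode ⟨q.user, s⟩))
    (hw : w' 1 = w 1 ∧ w' 2 = w 2 ∧ w' 3 = w 3 ∧ w' 5 = w 5 ∧ w' 6 = w 6) :
    Related P n (L + 2) w' x { st with requests := st.requests.set r ⟨q.user, s⟩ } := by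
  obtain ⟨h₁, h₂, h₃, h₅, h₆⟩ := hw
  refine ⟨h₁ ▸ h.users, h₂ ▸ h.contacts, h₃ ▸ h.directory, h₅ ▸ h.challenged, h₆ ▸ h.size,
    h.size_le.trans (by omega), h.users_le.trans (by omega), h.contacts_le.trans (by omega),
    by simpa using h.requests_le.trans (by omega), ?_⟩
  rcases h.requests with ⟨h₇, h₈, h₉⟩ | ⟨h₇, r₀, q₀, h₈, h₉, h₁₀⟩
  · exact .inl ⟨h₇, h₈, by rw [h₄, h₉, List.map_set]⟩
  · have hr : r ≠ r₀ := by
      rintro rfl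
      rw [h₁₀, List.getElem?_set_self (by simpa using (List.getElem?_eq_some_iff.1 hq).1)] at he
      exact hne (Option.some.inj he).symm
    exact .inr ⟨h₇, r₀, q₀, h₈, by rw [List.getElem?_set_ne hr, h₉], by
      rw [h₄, h₁₀, List.map_set, List.set_comm _ _ hr.symm]⟩

theorem eq_encode {r : ℕ} {q : Request} {e : Data}
    (h : Related P n L w x st) (hq : st.requests[r]? = some q) (he : (w 4).toList[r]? = some e)
    (hne : e ≠ .nil) : e = q.encode := by
  rcases h.requests with ⟨-, -, h₉⟩ | ⟨-, r₀, q₀, -, -, h₁₀⟩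
  · rw [h₉, List.getElem?_map, hq] at he
    exact (Option.some.inj he).symm
  · have hr : r₀ ≠ r := by
      rintro rfl
      rw [h₁₀, List.getElem?_set_self (by simpa using (List.getElem?_eq_some_iff.1 hq).1)] at he
      exact hne (Option.some.inj he).symm
    rw [h₁₀, List.getElem?_set_ne hr, List.getElem?_map, hq] at he
    exact (Option.some.inj he).symm

/-- The challenge opens two sessions, one of which is that of the receiver in the OT game. -/
theorem challenge {w' : Store} (h : Related P n L w x st)
    (second : Bool) (u₀ u₁ i₀ i₁ : ℕ) {y : Option Session}
    (hy : y = some ⟨if second then i₁ else i₀, .nil⟩)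
    (h₄ : (w 4).toList = st.requests.map Request.encode)
    (h₄' : (w' 4).toList = (w 4).toList ++ [if second then .cons (.num i₀) .nil else .nil,
      if second then .nil else .cons (.num i₁) .nil])
    (hw : w' 1 = w 1 ∧ w' 2 = w 2 ∧ w' 3 = w 3 ∧ w' 5 = .ofBool true ∧ w' 6 = w 6) :
    Related P n (L + 2) w' y
      { (st.openRequest u₀ i₀).openRequest u₁ i₁ with challenged := true } := by
  obtain ⟨h₁, h₂, h₃, h₅, h₆⟩ := hw
  have := h.requests_le
  refine ⟨h₁ ▸ h.users, h₂ ▸ h.contacts, h₃ ▸ h.directory, h₅, h₆ ▸ h.size,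
    h.size_le.trans (by omega), h.users_le.trans (by omega), h.contacts_le.trans (by omega),
    by simp [Users.openRequest]; omega, .inr ⟨rfl, ?_⟩⟩
  subst hy
  cases second
  · refine ⟨st.requests.length, ⟨u₀, ⟨i₀, .nil⟩⟩, rfl, by simp [Users.openRequest], ?_⟩
    simp [h₄', h₄, Users.openRequest, Request.encode]
  · refine ⟨st.requests.length + 1, ⟨u₁, ⟨i₁, .nil⟩⟩, rfl, by simp [Users.openRequest], ?_⟩
    simp [h₄', h₄, Users.openRequest, Request.encode]

end Related

theorem PMF_bind_eq {α β : Type} (p : PMF α) (f : α → PMF β) : (p >>= f) = p.bind f := rfl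

theorem PMF_pure_eq {α : Type} (a : α) : (pure a : PMF α) = PMF.pure a := rfl

theorem OT.challenger_none (ot : OT) {n i j : ℕ} (a : Bool)
    (hi : i < ot.size n) (hj : j < ot.size n) :
    ot.challenger n a none (.cons (.num i) (.num j)) =
      PMF.pure (some ⟨if a then j else i, .nil⟩, .ofBool true) := by
  simp only [OT.challenger, Data.hd_cons, Data.tl_cons, Data.toNat_num, hi, hj, and_self, if_true]
  rfl

/-- The program `p` answers as prescribed by `μ`, and the registers still describe the state of the
honest users afterwards. -/
def Answers (P : AOT) (n : ℕ) (a : Bool) (L : ℕ) (p : Prog) (w : Store) (x : Option Session)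
    (μ : PMF (Users × Data)) : Prop :=
  Couples (p.denote (P.ot.challenger n a) n (L + 2) w x) μ fun r r' =>
    Related P n (L + 2) r.1 r.2 r'.1 ∧ r.1 7 = r'.2

namespace AOT

open Prog

variable (P : AOT)

/-! The programs expect the query in register `7` and leave the answer there. Registers from `8` on
are used for intermediate results. -/

/-- Runs `p` if the list in register `16` has length `γ`, and answers `nil` otherwise. The lengths
agree if `find` uses up both the list and the number. -/
def checkBoard (p : Prog) : Prog :=
  .seq (find 16 (.reg 6)) (require (.eq (.cons (.reg 8) (.reg 9)) (.cons .nil .nil)) p)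

/-- The choice of a dummy request for the list in register `16`, put into register `11`. -/
def dummyIndexProg : Prog :=
  .seq (.alg P.dummyChoice 17 (.reg 16)) <|
  .seq (find 6 (.reg 17)) <| .cond (.reg 9) (.assign 11 (.reg 10)) (.assign 11 .nil)

/-- The answer to `Query.newUser`. -/
def newUserProg : Prog :=
  .seq (.alg P.keyGen 12 .nil) <|
  .seq (push 1 (.reg 12)) <|
  .assign 7 (.cons .nil (.hd (.reg 12)))

/-- The answer to `Query.meet`. -/
def meetProg : Prog :=
  .seq (find 1 (.hd (.tl (.reg 7)))) <|
  .seq (.assign 11 (.reg 9)) <|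
  .seq (find 1 (.tl (.tl (.reg 7)))) <|
  require (.reg 11) <| require (.reg 9) <|
  .seq (.assign 12 (.hd (.reg 11))) <|
  .seq (.assign 13 (.hd (.reg 9))) <|
  .seq (.alg P.secretGen 14 .nil) <|
  .seq (push 2 (.cons (.hd (.reg 13)) (.reg 14))) <|
  .seq (push 2 (.cons (.hd (.reg 12)) (.reg 14))) <|
  .assign 7 (.cons .nil .nil)

/-- The answer to `Query.meetCorrupt`. -/
def meetCorruptProg : Prog :=
  .seq (find 1 (.hd (.tl (.reg 7)))) <|
  require (.reg 9) <|
  .seq (push 2 (.cons (.hd (.tl (.tl (.reg 7)))) (.tl (.tl (.tl (.reg 7)))))) <|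
  .assign 7 (.cons .nil .nil)

/-- The answer to `Query.setDirectory`. -/
def setDirectoryProg : Prog :=
  .seq (.assign 3 (.tl (.reg 7))) (.assign 7 (.cons .nil .nil))

/-- The answer to `Query.send`. -/
def sendProg : Prog :=
  .seq (find 2 (.hd (.tl (.reg 7)))) <|
  require (.reg 9) <|
  .seq (.assign 12 (.hd (.reg 9))) <|
  .seq (.alg P.route 13 (.reg 3)) <|
  .seq (.alg P.nonceGen 14 .nil) <|
  .seq (.alg P.enc 14 (.cons (.hd (.reg 12)) (.cons (.hd (.tl (.tl (.reg 7)))) (.reg 14)))) <|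
  .seq (.alg P.kdf 12 (.cons (.tl (.reg 12)) (.hd (.tl (.tl (.tl (.reg 7))))))) <|
  .seq (.alg P.enc 14 (.cons (.tl (.tl (.reg 13))) (.cons (.reg 14) (.cons (.reg 12)
    (.cons (.hd (.tl (.reg 13))) (.tl (.tl (.tl (.tl (.reg 7)))))))))) <|
  .assign 7 (.cons (.hd (.reg 13)) (.cons (.reg 14) (.hd (.tl (.reg 13)))))

/-- The answer to `Query.fetch`. The length of the list is compared with `γ` before an entry is
looked up, since other lists may be longer than the clock. The last `find` only serves to turn the
position into the numeral that the receiver expects. -/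
def fetchProg : Prog :=
  .seq (.assign 16 (.hd (.tl (.tl (.tl (.reg 7)))))) <|
  .seq (find 2 (.hd (.tl (.reg 7)))) <|
  require (.reg 9) <|
  .seq (.assign 12 (.hd (.reg 9))) <|
  checkBoard <|
  .seq (find 16 (.tl (.tl (.tl (.tl (.reg 7)))))) <|
  require (.reg 9) <|
  .seq (.assign 11 (.hd (.reg 9))) <|
  .seq (.alg P.kdf 12 (.cons (.tl (.reg 12)) (.hd (.tl (.tl (.reg 7)))))) <|
  require (.eq (.reg 11) (.reg 12)) <|
  .seq (find 6 (.tl (.tl (.tl (.tl (.reg 7)))))) <|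
  .seq (push 4 (.cons (.reg 10) .nil)) <|
  .assign 7 (.cons .nil .nil)

/-- The answer to `Query.dummy`. -/
def dummyProg : Prog :=
  .seq (.assign 16 (.tl (.tl (.reg 7)))) <|
  .seq (find 1 (.hd (.tl (.reg 7)))) <|
  require (.reg 9) <|
  checkBoard <|
  .seq P.dummyIndexProg <|
  .seq (push 4 (.cons (.reg 11) .nil)) <|
  .assign 7 (.cons .nil .nil)

/-- The answer to `Query.deliver`. A session that is represented by `nil` is that of the receiver
in the OT game, to which the message is forwarded. -/
def deliverProg : Prog :=
  .seq (find 4 (.hd (.tl (.reg 7)))) <|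
  require (.reg 9) <|
  .cond (.hd (.reg 9))
    (.seq (.assign 12 (.hd (.reg 9))) <|
     .seq (.alg P.ot.receiver 13 (.cons (.reg 6) (.cons (.hd (.reg 12))
       (.cons (.tl (.reg 12)) (.tl (.tl (.reg 7))))))) <|
     .seq (.assign 9 (.cons (.cons (.hd (.reg 12)) (.hd (.reg 13))) (.tl (.reg 9)))) <|
     .seq rewind <|
     .seq (.assign 4 (.reg 9)) <|
     .assign 7 (.tl (.reg 13)))
    (.seq (.assign 12 (.tl (.tl (.reg 7)))) <|
     .seq (.call 12) <|
     .assign 7 (.reg 12))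

/-- The answer to `Query.challenge`. The receiver in the OT game is offered the choice between the
entry that the adversary has named and that of the dummy request, and takes over the second new
session if `second` is true and the first one otherwise. The remaining session asks for the entry of
the dummy request. The positions of the two users are compared through the rests of the list of
users from there on. -/
def challengeProg (second : Bool) : Prog :=
  .seq (.assign 16 (.hd (.tl (.tl (.tl (.reg 7)))))) <|
  require (.eq (.reg 5) .nil) <|
  .seq (find 1 (.hd (.tl (.reg 7)))) <|
  require (.reg 9) <|
  .seq (.assign 13 (.reg 9)) <|
  .seq (find 1 (.hd (.tl (.tl (.reg 7))))) <|
  require (.reg 9) <|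
  require (.eq (.eq (.reg 13) (.reg 9)) .nil) <|
  checkBoard <|
  .seq (find 6 (.tl (.tl (.tl (.tl (.reg 7)))))) <|
  require (.reg 9) <|
  .seq (.assign 14 (.reg 10)) <|
  .seq P.dummyIndexProg <|
  .seq (.assign 12 (if second then .cons (.reg 11) (.reg 14) else .cons (.reg 14) (.reg 11))) <|
  .seq (.call 12) <|
  .seq (push 4 (if second then .cons (.reg 11) .nil else .nil)) <|
  .seq (push 4 (if second then .nil else .cons (.reg 11) .nil)) <|
  .seq (.assign 5 (.cons .nil .nil)) <|
  .assign 7 (.cons .nil (.reg 11))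

variable {P} {n L : ℕ} {a : Bool} {w : Store} {x : Option Session} {st : Users}

theorem answers_pure {μ : PMF (Users × Data)} {w' : Store} (h : Related P n L w x st)
    (hw : w' 1 = w 1 ∧ w' 2 = w 2 ∧ w' 3 = w 3 ∧ w' 4 = w 4 ∧ w' 5 = w 5 ∧ w' 6 = w 6)
    (hμ : μ = PMF.pure (st, w' 7)) :
    Couples (PMF.pure (w', x)) μ fun r r' => Related P n (L + 2) r.1 r.2 r'.1 ∧ r.1 7 = r'.2 := by
  rw [hμ]
  exact .pure ⟨h.congr hw, rfl⟩

theorem denote_find_user (h : Related P n L w x st) (w₀ : Store) (hw : w₀ 1 = w 1) (i : Expr) :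
    ∃ w', (∀ x, (find 1 i).denote (P.ot.challenger n a) n (L + 2) w₀ x = PMF.pure (w', x)) ∧
      (∀ k, k ≠ 8 → k ≠ 9 → k ≠ 10 → w' k = w₀ k) ∧
      ((w' 9 = .nil ∧ st.users[(i.eval w₀).toNat]? = none ∧ st.users.length ≤ (i.eval w₀).toNat) ∨
        ∃ keys r, w' 9 = .cons keys r ∧ st.users[(i.eval w₀).toNat]? = some keys ∧
          (i.eval w₀).toNat < st.users.length ∧ (w' 9).toList = st.users.drop (i.eval w₀).toNat) := by
  obtain ⟨w', h₁, h₂, -, h₃, -⟩ := denote_find (P.ot.challenger n a) n (L := L + 2) (l := 1)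
    (i := i) (w := w₀) (by omega) (.inl (by rw [hw, h.toNat_users]; have := h.users_le; omega))
  refine ⟨w', h₁, h₂, ?_⟩
  rw [hw, h.users] at h₃
  rcases h9 : w' 9 with _ | ⟨keys, r⟩
  · rw [h9] at h₃
    exact .inl ⟨rfl, Data.getElem?_of_nil_eq_drop h₃⟩
  · rw [h9] at h₃
    obtain ⟨h₄, h₅⟩ := Data.getElem?_of_cons_eq_drop h₃
    exact .inr ⟨keys, r, rfl, h₄, h₅, h₃⟩

theorem denote_find_contact (h : Related P n L w x st) (w₀ : Store) (hw : w₀ 2 = w 2) (i : Expr) :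
    ∃ w', (∀ x, (find 2 i).denote (P.ot.challenger n a) n (L + 2) w₀ x = PMF.pure (w', x)) ∧
      (∀ k, k ≠ 8 → k ≠ 9 → k ≠ 10 → w' k = w₀ k) ∧
      ((w' 9 = .nil ∧ st.contacts[(i.eval w₀).toNat]? = none) ∨
        ∃ B r, w' 9 = .cons (Contact.encode B) r ∧ st.contacts[(i.eval w₀).toNat]? = some B) := by
  obtain ⟨w', h₁, h₂, -, h₃, -⟩ := denote_find (P.ot.challenger n a) n (L := L + 2) (l := 2)
    (i := i) (w := w₀) (by omega)
    (.inl (by rw [hw, h.toNat_contacts]; have := h.contacts_le; omega))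
  refine ⟨w', h₁, h₂, ?_⟩
  rw [hw, h.contacts] at h₃
  rcases h9 : w' 9 with _ | ⟨B, r⟩
  · rw [h9] at h₃
    exact .inl ⟨rfl, by simpa using (Data.getElem?_of_nil_eq_drop h₃).1⟩
  · rw [h9] at h₃
    have := (Data.getElem?_of_cons_eq_drop h₃).1
    rw [List.getElem?_map, Option.map_eq_some_iff] at this
    obtain ⟨c, hc, rfl⟩ := this
    exact .inr ⟨c, r, rfl, hc⟩

theorem newUser_answers (h : Related P n L w x st) :
    Answers P n a L P.newUserProg w x (P.answer n false st .newUser) := by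
  simp only [Answers, answer, newUserProg, denote, PMF_bind_eq, PMF_pure_eq, PMF.bind_map,
    Function.comp_def]
  refine .bind_same fun keys => ?_
  obtain ⟨w₁, h₁, h₂, h₃⟩ := denote_push (P.ot.challenger n a) n (L := L + 2) (l := 1)
    (e := .reg 12) (w := Function.update w 12 keys) (by omega)
    (by simp [h.toNat_users]; have := h.users_le; omega)
  rw [h₁, PMF.pure_bind]
  refine .pure ⟨h.addUser (keys := keys) ?_ ?_, ?_⟩
  · simp [h₃, Expr.eval]
  · simp [h₂]
  · simp [h₂, Expr.eval]

theorem meet_answers (h : Related P n L w x st) :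
    Answers P n a L P.meetProg w x
      (P.answer n false st (.meet (w 7).tl.hd.toNat (w 7).tl.tl.toNat)) := by
  simp only [Answers, answer, meetProg, require, denote]
  obtain ⟨w₁, h₁, h₂, h₃⟩ := denote_find_user (a := a) h w rfl (.hd (.tl (.reg 7)))
  obtain ⟨w₂, h₄, h₅, h₆⟩ := denote_find_user (a := a) h (Function.update w₁ 11 (w₁ 9))
    (by simp [h₂]) (.tl (.tl (.reg 7)))
  simp only [Expr.eval, h₁, h₄, PMF.pure_bind]
  simp only [Expr.eval] at h₃ h₆
  have e7 : Function.update w₁ 11 (w₁ 9) 7 = w 7 := by simp [h₂]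
  rw [e7] at h₆
  have e11 : w₂ 11 = w₁ 9 := by simp [h₅]
  rcases h₃ with ⟨h₇, h₈, -⟩ | ⟨keysU, r, h₇, h₈, -⟩
  · simp only [e11, h₇, h₈, if_true]
    exact answers_pure h (by simp [h₅, h₂]) (by simp [PMF_pure_eq])
  rcases h₆ with ⟨h₉, h₁₀, -⟩ | ⟨keysV, r', h₉, h₁₀, -⟩
  · simp only [e11, h₇, h₈, h₉, h₁₀, if_true, if_false, reduceCtorEq]
    exact answers_pure h (by simp [h₅, h₂]) (by simp [PMF_pure_eq])
  simp only [e11, h₇, h₈, h₉, h₁₀, if_false, reduceCtorEq, PMF_bind_eq,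
    PMF_pure_eq, PMF.bind_map, Function.comp_def]
  refine .bind_same fun s => ?_
  have hle := h.contacts_le
  obtain ⟨w₃, h₁₁, h₁₂, h₁₃⟩ := denote_push (P.ot.challenger n a) n (L := L + 2) (l := 2)
    (e := .cons (.hd (.reg 13)) (.reg 14)) (w := Function.update
            (Function.update (Function.update w₂ 12 (keysU.cons r).hd) 13
              (Function.update w₂ 12 (keysU.cons r).hd 9).hd)
            14 s) (by omega) (by simp [h₅, h₂, h.toNat_contacts]; omega)
  simp [Expr.eval, h₉, h₅, h₂] at h₁₃
  obtain ⟨w₄, h₁₄, h₁₅, h₁₆⟩ := denote_push (P.ot.challenger n a) n (L := L + 2) (l := 2)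
    (e := .cons (.hd (.reg 12)) (.reg 14)) (w := w₃) (by omega)
    (by rw [Data.toNat, h₁₃, h.contacts]; simp; omega)
  simp [Expr.eval, h₁₂, h₁₃] at h₁₆
  simp only [h₁₁, h₁₄, PMF.pure_bind]
  refine .pure ⟨h.addContacts (by simp) ?_ ?_, ?_⟩
  · simp [h₁₆, Contact.encode]
  · simp [h₁₅, h₁₂, h₅, h₂]
  · simp [Data.ofBool]

theorem meetCorrupt_answers (h : Related P n L w x st) :
    Answers P n a L meetCorruptProg w x
      (P.answer n false st (.meetCorrupt (w 7).tl.hd.toNat (w 7).tl.tl.hd (w 7).tl.tl.tl)) := by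
  simp only [Answers, answer, meetCorruptProg, require, denote]
  obtain ⟨w₁, h₁, h₂, h₃⟩ := denote_find_user (a := a) h w rfl (.hd (.tl (.reg 7)))
  simp only [Expr.eval, h₁, PMF.pure_bind]
  simp only [Expr.eval] at h₃
  rcases h₃ with ⟨h₇, h₈, -⟩ | ⟨keysU, r, h₇, h₈, -⟩
  · simp only [h₇, h₈, if_true]
    exact answers_pure h (by simp [h₂]) (by simp [PMF_pure_eq])
  have hle := h.contacts_le
  obtain ⟨w₃, h₁₁, h₁₂, h₁₃⟩ := denote_push (P.ot.challenger n a) n (L := L + 2) (l := 2)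
    (e := .cons (.hd (.tl (.tl (.reg 7)))) (.tl (.tl (.tl (.reg 7))))) (w := w₁) (by omega)
    (by simp [h₂, h.toNat_contacts]; omega)
  simp only [h₇, h₈, h₁₁, if_false, reduceCtorEq, PMF_pure_eq, PMF.pure_bind]
  refine .pure ⟨h.addContacts (by simp) ?_ ?_, ?_⟩
  · simp [h₁₃, h₂, Contact.encode, Expr.eval]
  · simp [h₁₂, h₂]
  · simp [Data.ofBool]

theorem setDirectory_answers (h : Related P n L w x st) :
    Answers P n a L setDirectoryProg w x (P.answer n false st (.setDirectory (w 7).tl)) := by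
  simp only [Answers, answer, setDirectoryProg, denote, PMF.pure_bind, PMF_pure_eq]
  refine .pure ⟨?_, ?_⟩
  · convert h.setDirectory (w' := _) ?_ using 2
    · simp [Expr.eval]
    · simp
  · simp [Data.ofBool, Expr.eval]

theorem send_answers (h : Related P n L w x st) :
    Answers P n a L P.sendProg w x (P.answer n false st
      (.send (w 7).tl.hd.toNat (w 7).tl.tl.hd (w 7).tl.tl.tl.hd (w 7).tl.tl.tl.tl)) := by
  simp only [Answers, answer, sendProg, require, denote]
  obtain ⟨w₁, h₁, h₂, h₃⟩ := denote_find_contact (a := a) h w rfl (.hd (.tl (.reg 7)))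
  simp only [Expr.eval, h₁, PMF.pure_bind]
  simp only [Expr.eval] at h₃
  rcases h₃ with ⟨h₇, h₈⟩ | ⟨B, r, h₇, h₈⟩
  · simp only [h₇, h₈, if_true]
    exact answers_pure h (by simp [h₂]) (by simp [PMF_pure_eq])
  simp only [h₇, h₈, if_false, reduceCtorEq, PMF_pure_eq, PMF_bind_eq, PMF.bind_map,
    Function.comp_def, compose, PMF.bind_bind, PMF.pure_bind]
  simp [h₂, Contact.encode, ← h.directory]
  refine .bind_same fun r => .bind_same fun nonce => .bind_same fun M => .bind_same fun k =>
    .bind_same fun e => answers_pure h ?_ ?_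
  · simp [h₂]
  · simp

theorem denote_find_board (h : Related P n L w x st) (w₀ : Store) (hw : w₀ 6 = w 6) :
    ∃ w', (∀ x, (find 16 (.reg 6)).denote (P.ot.challenger n a) n (L + 2) w₀ x = PMF.pure (w', x)) ∧
      (∀ k, k ≠ 8 → k ≠ 9 → k ≠ 10 → w' k = w₀ k) ∧
      (Data.cons (w' 8) (w' 9) = .cons .nil .nil ↔ (w₀ 16).toList.length = P.γ n) := by
  obtain ⟨w', h₁, h₂, h₃, h₄, -⟩ := denote_find (P.ot.challenger n a) n (L := L + 2) (l := 16)
    (i := .reg 6) (w := w₀) (by omega)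
    (.inr (by simp only [Expr.eval]; rw [hw, h.size, Data.toNat_num]; have := h.size_le; omega))
  refine ⟨w', h₁, h₂, ?_⟩
  simp only [Expr.eval, hw, h.size, Data.toList_num, Data.toNat_num] at h₃ h₄
  have e : ∀ d : Data, d = .nil ↔ d.toList = [] := fun d =>
    ⟨fun h => by rw [h]; rfl, fun h => Data.toList_injective (by rw [h]; rfl)⟩
  rw [Data.cons.injEq, e, e, h₃, h₄, List.drop_eq_nil_iff, List.drop_eq_nil_iff,
    List.length_replicate, Data.toNat]
  omega

theorem denote_find_index (h : Related P n L w x st) (w₀ : Store) (hw : w₀ 6 = w 6) (i : Expr) :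
    ∃ w', (∀ x, (find 6 i).denote (P.ot.challenger n a) n (L + 2) w₀ x = PMF.pure (w', x)) ∧
      (∀ k, k ≠ 8 → k ≠ 9 → k ≠ 10 → w' k = w₀ k) ∧
      (w' 9 = .nil ↔ ¬ (i.eval w₀).toNat < P.γ n) ∧
      ((i.eval w₀).toNat < P.γ n → w' 10 = .num (i.eval w₀).toNat) := by
  obtain ⟨w', h₁, h₂, -, h₄, h₅⟩ := denote_find (P.ot.challenger n a) n (L := L + 2) (l := 6)
    (i := i) (w := w₀) (by omega)
    (.inl (by rw [hw, h.size, Data.toNat_num]; have := h.size_le; omega))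
  refine ⟨w', h₁, h₂, ?_, fun hi => Data.toList_injective ?_⟩
  · rw [hw, h.size, Data.toList_num] at h₄
    rw [← Data.toNat_eq_zero, Data.toNat, h₄]
    simp
    omega
  · rw [h₅, hw, h.size, Data.toList_num, Data.toList_num, List.take_replicate,
      List.reverse_replicate, min_eq_left hi.le]

theorem dummyIndexProg_couples (h : Related P n L w x st) (w₀ : Store) (hw : w₀ 6 = w 6)
    (y : Option Session) :
    Couples (P.dummyIndexProg.denote (P.ot.challenger n a) n (L + 2) w₀ y)
      (P.dummyIndex n (w₀ 16)) fun r j => r.2 = y ∧ r.1 11 = .num j ∧ (0 < P.γ n → j < P.γ n) ∧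
        ∀ k, k ≠ 8 → k ≠ 9 → k ≠ 10 → k ≠ 11 → k ≠ 17 → r.1 k = w₀ k := by
  simp only [dummyIndexProg, dummyIndex, denote, Expr.eval, PMF.bind_map, Function.comp_def]
  refine .bind_same fun d => ?_
  rw [Function.comp_apply]
  obtain ⟨w₁, h₁, h₂, h₃, h₄⟩ := denote_find_index (a := a) h (Function.update w₀ 17 d)
    (by simp [hw]) (.reg 17)
  simp only [Expr.eval, Function.update_self] at h₃ h₄
  simp only [h₁, PMF.pure_bind, h₃]
  by_cases hd : d.toNat < P.γ n
  · simp only [hd, not_true, if_false, if_true, h₄]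
    exact .pure ⟨rfl, by simp, fun _ => hd, fun k _ _ _ _ _ => by simp [*]⟩
  · simp only [hd, not_false_eq_true, if_true, if_false]
    exact .pure ⟨rfl, by simp [Data.num], id, fun k _ _ _ _ _ => by simp [*]⟩

theorem fetch_answers (h : Related P n L w x st) :
    Answers P n a L P.fetchProg w x (P.answer n false st
      (.fetch (w 7).tl.hd.toNat (w 7).tl.tl.hd (w 7).tl.tl.tl.hd (w 7).tl.tl.tl.tl.toNat)) := by
  simp only [Answers, answer, fetchProg, checkBoard, require, denote]
  obtain ⟨w₁, h₁, h₂, h₃⟩ := denote_find_contact (a := a) h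
    (Function.update w 16 (w 7).tl.tl.tl.hd) (by simp) (.hd (.tl (.reg 7)))
  have e7 : Function.update w 16 (w 7).tl.tl.tl.hd 7 = w 7 := by simp
  simp only [Expr.eval, e7] at h₃
  simp only [Expr.eval, h₁, PMF.pure_bind]
  rcases h₃ with ⟨h₇, h₈⟩ | ⟨B, r, h₇, h₈⟩
  · simp only [h₇, h₈, if_true]
    exact answers_pure h (by simp [h₂]) (by simp [PMF_pure_eq])
  obtain ⟨w₂, h₁₁, h₁₂, h₁₃⟩ := denote_find_board (a := a) h
    (Function.update w₁ 12 (Contact.encode B)) (by simp [h₂])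
  have e16 : Function.update w₁ 12 (Contact.encode B) 16 = (w 7).tl.tl.tl.hd := by simp [h₂]
  rw [e16] at h₁₃
  simp only [h₇, h₈, if_false, reduceCtorEq, Data.hd_cons, h₁₁, PMF.pure_bind, h₁₃]
  by_cases hb : (w 7).tl.tl.tl.hd.toList.length = P.γ n
  swap
  · simp only [hb, decide_false, Data.ofBool, if_true, false_and, if_false]
    refine answers_pure h (by simp [h₁₂, h₂]) ?_
    -- The tag that `AOT.answer` computes before it looks at the length is discarded.
    cases (w 7).tl.tl.tl.hd.toList[(w 7).tl.tl.tl.tl.toNat]? <;>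
      simp [PMF_pure_eq, PMF_bind_eq, PMF.bind_const]
  have e16' : w₂ 16 = (w 7).tl.tl.tl.hd := by simp [h₁₂, h₂]
  have e7' : w₂ 7 = w 7 := by simp [h₁₂, h₂]
  obtain ⟨w₃, h₁₄, h₁₅, -, h₁₆, -⟩ := denote_find (P.ot.challenger n a) n (L := L + 2) (l := 16)
    (i := .tl (.tl (.tl (.tl (.reg 7))))) (w := w₂) (by omega)
    (.inl (by rw [e16', Data.toNat, hb]; have := h.size_le; omega))
  simp only [Expr.eval, e16', e7'] at h₁₆
  simp only [hb, decide_true, Data.ofBool, true_and, reduceCtorEq, if_false, h₁₄, PMF.pure_bind]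
  rcases h9 : w₃ 9 with _ | ⟨tag, r'⟩
  · rw [h9] at h₁₆
    simp only [(Data.getElem?_of_nil_eq_drop h₁₆).1, if_true]
    exact answers_pure h (by simp [h₁₅, h₁₂, h₂]) (by simp [PMF_pure_eq])
  rw [h9] at h₁₆
  have hi := (Data.getElem?_of_cons_eq_drop h₁₆).2
  simp only [(Data.getElem?_of_cons_eq_drop h₁₆).1, reduceCtorEq, if_false, Data.hd_cons, PMF.bind_map,
    Function.comp_def, PMF_bind_eq, PMF_pure_eq]
  have e₁ : (Function.update w₃ 11 tag 12).tl = B.secret := by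
    simp [h₁₅, h₁₂, Contact.encode]
  have e₂ : Function.update w₃ 11 tag 7 = w 7 := by simp [h₁₅, e7']
  rw [e₁, e₂]
  refine .bind_same fun t => ?_
  have e₃ : ∀ t, Function.update (Function.update w₃ 11 tag) 12 t 11 = tag := fun t => by simp
  simp only [Function.update_self, e₃]
  by_cases ht : tag = t
  swap
  · simp only [ht, decide_false, if_true, if_false]
    exact answers_pure h (by simp [h₁₅, h₁₂, h₂]) (by simp)
  obtain ⟨w₄, h₁₇, h₁₈, -, h₁₉⟩ := denote_find_index (a := a) h
    (Function.update (Function.update w₃ 11 tag) 12 t) (by simp [h₁₅, h₁₂, h₂])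
    (.tl (.tl (.tl (.tl (.reg 7)))))
  have e₄ : Function.update (Function.update w₃ 11 tag) 12 t 7 = w 7 := by simp [h₁₅, e7']
  simp only [Expr.eval, e₄] at h₁₉
  obtain ⟨w₅, h₂₀, h₂₁, h₂₂⟩ := denote_push (P.ot.challenger n a) n (L := L + 2) (l := 4)
    (e := .cons (.reg 10) .nil) (w := w₄) (by omega)
    (by have := h.requests_le; simp [h₁₈, h₁₅, h₁₂, h₂, h.toNat_requests]; omega)
  simp only [ht, decide_true, reduceCtorEq, if_true, if_false]
  rw [← ht]
  rw [← ht] at h₁₇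
  simp only [h₁₇, h₂₀, PMF.pure_bind]
  refine .pure ⟨h.openRequest ?_ ?_, ?_⟩
  · simp [h₂₂, h₁₈, h₁₅, h₁₂, h₂, Expr.eval, h₁₉ (hb ▸ hi)]
  · simp [h₂₁, h₁₈, h₁₅, h₁₂, h₂]
  · simp

theorem dummy_answers (h : Related P n L w x st) :
    Answers P n a L P.dummyProg w x (P.answer n false st
      (.dummy (w 7).tl.hd.toNat (w 7).tl.tl)) := by
  simp only [Answers, answer, dummyProg, checkBoard, require, denote]
  obtain ⟨w₁, h₁, h₂, h₃⟩ := denote_find_user (a := a) h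
    (Function.update w 16 (w 7).tl.tl) (by simp) (.hd (.tl (.reg 7)))
  simp only [Expr.eval, h₁, PMF.pure_bind]
  have e7 : Function.update w 16 (w 7).tl.tl 7 = w 7 := by simp
  simp only [Expr.eval, e7] at h₃
  rcases h₃ with ⟨h₇, -, h₈⟩ | ⟨keysU, r, h₇, -, h₈, -⟩
  · simp only [h₇, if_true]
    exact answers_pure h (by simp [h₂]) (by rw [if_neg (by omega)]; simp [PMF_pure_eq])
  obtain ⟨w₂, h₁₁, h₁₂, h₁₃⟩ := denote_find_board (a := a) h w₁ (by simp [h₂])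
  have e16 : w₁ 16 = (w 7).tl.tl := by simp [h₂]
  rw [e16] at h₁₃
  simp only [h₇, if_false, reduceCtorEq, h₁₁, PMF.pure_bind, h₁₃]
  by_cases hb : (w 7).tl.tl.toList.length = P.γ n
  swap
  · simp only [hb, decide_false, Data.ofBool, if_true, and_false, if_false]
    exact answers_pure h (by simp [h₁₂, h₂]) (by simp [PMF_pure_eq])
  simp only [hb, decide_true, Data.ofBool, if_true, and_true, h₈, reduceCtorEq, if_false,
    PMF_bind_eq, PMF_pure_eq]
  have e16' : w₂ 16 = (w 7).tl.tl := by simp [h₁₂, h₂]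
  rw [← e16']
  refine (dummyIndexProg_couples (a := a) h w₂ (by simp [h₁₂, h₂]) x).bind ?_
  rintro ⟨w₃, y⟩ j ⟨h₁₄, h₁₅, -, h₁₆⟩
  obtain rfl : y = x := h₁₄
  dsimp only at h₁₅ h₁₆
  obtain ⟨w₄, h₁₇, h₁₈, h₁₉⟩ := denote_push (P.ot.challenger n a) n (L := L + 2) (l := 4)
    (e := .cons (.reg 11) .nil) (w := w₃) (by omega)
    (by have := h.requests_le; simp [h₁₆, h₁₂, h₂, h.toNat_requests]; omega)
  simp only [h₁₇, PMF.pure_bind]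
  refine .pure ⟨h.openRequest ?_ ?_, ?_⟩
  · simp [h₁₉, h₁₆, h₁₂, h₂, Expr.eval, h₁₅]
  · simp [h₁₈, h₁₆, h₁₂, h₂]
  · simp

theorem deliver_answers (h : Related P n L w x st) :
    Answers P n a L P.deliverProg w x (P.answer n false st
      (.deliver (w 7).tl.hd.toNat (w 7).tl.tl)) := by
  simp only [Answers, answer, deliverProg, require, denote]
  obtain ⟨w₁, h₁, h₂, -, h₃, h₄⟩ := denote_find (P.ot.challenger n a) n (L := L + 2) (l := 4)
    (i := .hd (.tl (.reg 7))) (w := w) (by omega)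
    (.inl (by rw [h.toNat_requests]; have := h.requests_le; omega))
  simp only [Expr.eval] at h₃ h₄
  simp only [Expr.eval, h₁, PMF.pure_bind]
  generalize (w 7).tl.hd.toNat = r at *
  have hlen := h.toNat_requests
  rw [Data.toNat] at hlen
  rcases h9 : w₁ 9 with _ | ⟨e, l⟩
  · rw [h9] at h₃
    have : st.requests[r]? = none := by
      have := (Data.getElem?_of_nil_eq_drop h₃).2
      exact List.getElem?_eq_none (by omega)
    simp only [this, if_true]
    exact answers_pure h (by simp [h₂]) (by simp [PMF_pure_eq])
  rw [h9] at h₃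
  obtain ⟨h₅, h₆⟩ := Data.getElem?_of_cons_eq_drop h₃
  obtain ⟨q, hq⟩ : ∃ q, st.requests[r]? = some q :=
    ⟨_, List.getElem?_eq_getElem (by omega)⟩
  simp only [reduceCtorEq, if_false, hq, Data.hd_cons]
  rcases he : e with _ | ⟨c, s⟩
  · -- the session of the receiver in the OT game
    rw [he] at h₅
    rcases h.requests with ⟨_, _, h₈⟩ | ⟨h₇, r₀, q₀, h₈, h₉, h₁₀⟩
    · rw [h₈, List.getElem?_map, hq] at h₅
      simp [Request.encode] at h₅
    · obtain rfl : r₀ = r := by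
        by_contra hne
        rw [h₁₀, List.getElem?_set_ne hne, List.getElem?_map, hq] at h₅
        simp [Request.encode] at h₅
      obtain rfl : q₀ = q := by
        rw [hq] at h₉
        exact (Option.some.inj h₉).symm
      have e12 : ∀ d, Function.update w₁ 12 d 12 = d := fun d => Function.update_self ..
      have e7 : w₁ 7 = w 7 := by simp [h₂]
      simp only [Data.hd_nil, if_true, e12, e7, h₈, OT.challenger, PMF_bind_eq, PMF_pure_eq,
        PMF.map_bind, PMF.bind_bind, PMF.pure_map, PMF.pure_bind]
      refine .bind_same fun r => .pure ⟨?_, ?_⟩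
      · subst h₈
        exact (h.congr (by simp [h₂])).setExternal h₇ hq (by simp [h₂, h₁₀]) r.1
      · simp
  · -- a session that the program conducts
    rw [he] at h₅ h₃
    have henc := h.eq_encode hq h₅ Data.noConfusion
    obtain ⟨rfl, rfl⟩ := Data.cons.inj henc
    have e₁ : ∀ d, Function.update w₁ 12 d 12 = d := fun d => Function.update_self ..
    have e₂ : ∀ d, Function.update w₁ 12 d 6 = .num (P.γ n) := fun d => by simp [h₂, h.size]
    have e₃ : ∀ d, Function.update w₁ 12 d 7 = w 7 := fun d => by simp [h₂]
    simp only [Data.hd_cons, Data.tl_cons, reduceCtorEq, if_false, e₁, e₂, e₃, OT.respond,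
      PMF_bind_eq, PMF_pure_eq, PMF.bind_map, PMF.bind_bind, PMF.pure_bind, Function.comp_def, γ]
    refine .bind_same fun d => ?_
    have h10 : (w₁ 10).toList = ((w 4).toList.take r).reverse := h₄
    obtain ⟨w₂, h₇, h₈, h₉⟩ := denote_rewind (P.ot.challenger n a) n (L := L + 2)
      (w := Function.update (Function.update (Function.update w₁ 12 q.encode) 13 d) 9
        (.cons (.cons (.num q.session.choice) d.hd) l)) (by
        have := h.requests_le
        simp [Data.toNat, h10]; omega)
    have e₄ : Data.cons ((Function.update (Function.update w₁ 12
          ((Data.num q.session.choice).cons q.session.state)) 13 d 12).hd.cons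
          (Function.update (Function.update w₁ 12
          ((Data.num q.session.choice).cons q.session.state)) 13 d 13).hd)
          (Function.update (Function.update w₁ 12
          ((Data.num q.session.choice).cons q.session.state)) 13 d 9).tl =
        .cons (.cons (.num q.session.choice) d.hd) l := by simp [h9, he]
    rw [e₄]
    rw [Request.encode] at h₇
    simp only [h₇, PMF.pure_bind]
    refine .pure ⟨h.setRequest hq h₅ Data.noConfusion ⟨q.session.choice, d.hd⟩ ?_ ?_, ?_⟩
    · have h₁₀ : l.toList = (w 4).toList.drop (r + 1) := by
        rw [List.drop_add_one_eq_tail_drop, ← h₃]; rfl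
      rw [List.set_eq_take_append_cons_drop, if_pos h₆, ← h₁₀]
      simp [h₉, h10, Request.encode]
    · simp [h₈, h₂]
    · simp [h₈]

/-! ### The hybrid games -/

/-- The anonymity game with arbitrary choices in the challenge: the first new session asks for the
message `m'` of the dummy request if `v₀` is true and for `m` otherwise, and likewise for the second
one and `v₁`. -/
noncomputable def hybridAnswer (P : AOT) (n : ℕ) (v₀ v₁ : Bool) (st : Users) :
    Query → PMF (Users × Data)
  | .challenge u₀ u₁ board i =>
      if st.challenged = false ∧ u₀ < st.users.length ∧ u₁ < st.users.length ∧ u₀ ≠ u₁ ∧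
          board.toList.length = P.γ n ∧ i < P.γ n then do
        let j ← P.dummyIndex n board
        let st₀ := st.openRequest u₀ (if v₀ then j else i)
        let st₁ := st₀.openRequest u₁ (if v₁ then j else i)
        return ({ st₁ with challenged := true }, .cons .nil (.num j))
      else
        return (st, .nil)
  | q => P.answer n false st q

theorem answer_eq_hybridAnswer (P : AOT) (n : ℕ) (b : Bool) (st : Users) (q : Query) :
    P.answer n b st q = P.hybridAnswer n b (!b) st q := by
  cases q <;> cases b <;> rfl

theorem challenge_answers (h : Related P n L w x st) (second : Bool) :
    Answers P n a L (P.challengeProg second) w x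
      (P.hybridAnswer n (if second then true else a) (if second then !a else true) st
      (.challenge (w 7).tl.hd.toNat (w 7).tl.tl.hd.toNat (w 7).tl.tl.tl.hd
        (w 7).tl.tl.tl.tl.toNat)) := by
  simp only [Answers, hybridAnswer, challengeProg, checkBoard, require, denote, PMF.pure_bind,
    Expr.eval]
  obtain ⟨w₀, hw₀⟩ : ∃ w₀, w₀ = Function.update w 16 (w 7).tl.tl.tl.hd := ⟨_, rfl⟩
  have e16 : w₀ 16 = (w 7).tl.tl.tl.hd := by simp [hw₀]
  have e₀ : ∀ k, k ≠ 16 → w₀ k = w k := fun k hk => by simp [hw₀, hk]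
  have e5 : w₀ 5 = .ofBool st.challenged := by rw [e₀ 5 (by omega), h.challenged]
  rw [← hw₀]
  simp only [e5]
  clear hw₀
  rcases hc : st.challenged with _ | _
  swap
  · simp only [Data.ofBool, reduceCtorEq, decide_false, if_true, if_false, false_and]
    exact answers_pure h (by simp [e₀]) (by simp [PMF_pure_eq])
  simp only [Data.ofBool, reduceCtorEq, decide_true, if_false, true_and]
  -- the first user
  obtain ⟨w₁, h₁, h₂, h₃⟩ := denote_find_user (a := a) h w₀ (e₀ 1 (by omega)) (.hd (.tl (.reg 7)))
  simp only [Expr.eval, e₀ 7 (by omega)] at h₃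
  simp only [h₁, PMF.pure_bind]
  rcases h₃ with ⟨h₄, -, h₅⟩ | ⟨keys, r, h₄, -, h₅, h₆⟩
  · simp only [h₄, if_true]
    exact answers_pure h (by simp [h₂, e₀]) (by rw [if_neg (by omega)]; simp [PMF_pure_eq])
  have h9 : w₁ 9 ≠ .nil := by simp [h₄]
  simp only [h9, if_false, h₅, true_and]
  -- the second user
  have e₁ : ∀ k, k ≠ 8 → k ≠ 9 → k ≠ 10 → k ≠ 13 → k ≠ 16 →
      Function.update w₁ 13 (w₁ 9) k = w k := fun k _ _ _ _ _ => by simp [*]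
  obtain ⟨w₂, h₇, h₈, h₉⟩ := denote_find_user (a := a) h (Function.update w₁ 13 (w₁ 9))
    (e₁ 1 (by omega) (by omega) (by omega) (by omega) (by omega)) (.hd (.tl (.tl (.reg 7))))
  simp only [Expr.eval, e₁ 7 (by omega) (by omega) (by omega) (by omega) (by omega)] at h₉
  simp only [h₇, PMF.pure_bind]
  have e₂ : ∀ k, k ≠ 8 → k ≠ 9 → k ≠ 10 → k ≠ 13 → k ≠ 16 → w₂ k = w k :=
    fun k _ _ _ _ _ => by simp [*]
  rcases h₉ with ⟨h₁₀, -, h₁₁⟩ | ⟨keys', r', h₁₀, -, h₁₁, h₁₂⟩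
  · simp only [h₁₀, if_true]
    exact answers_pure h (by simp [e₂]) (by rw [if_neg (by omega)]; simp [PMF_pure_eq])
  have h9' : w₂ 9 ≠ .nil := by simp [h₁₀]
  have e13 : w₂ 13 = w₁ 9 := by simp [h₈]
  have hu : w₁ 9 = w₂ 9 ↔ (w 7).tl.hd.toNat = (w 7).tl.tl.hd.toNat := by
    refine ⟨fun he => ?_, fun he => Data.toList_injective (by rw [h₆, h₁₂, he])⟩
    rw [he, h₁₂] at h₆
    have := congrArg List.length h₆
    simp only [List.length_drop] at this
    omega
  simp only [h9', if_false, h₁₁, true_and, e13, hu]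
  by_cases hne : (w 7).tl.hd.toNat = (w 7).tl.tl.hd.toNat
  · simp only [hne, decide_true, reduceCtorEq, decide_false, if_true, if_false,
      ne_eq, not_true, false_and]
    exact answers_pure h (by simp [e₂]) (by simp [PMF_pure_eq])
  simp only [hne, decide_false, decide_true, reduceCtorEq, if_false, ne_eq,
    not_false_eq_true, true_and]
  -- the board
  obtain ⟨w₃, h₁₃, h₁₄, h₁₅⟩ := denote_find_board (a := a) h w₂ (e₂ 6 (by omega) (by omega)
    (by omega) (by omega) (by omega))
  have e16' : w₂ 16 = (w 7).tl.tl.tl.hd := by simp [h₈, h₂, e16]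
  rw [e16'] at h₁₅
  simp only [h₁₃, PMF.pure_bind, h₁₅]
  have e₃ : ∀ k, k ≠ 8 → k ≠ 9 → k ≠ 10 → k ≠ 13 → k ≠ 16 → w₃ k = w k :=
    fun k _ _ _ _ _ => by simp [*]
  by_cases hb : (w 7).tl.tl.tl.hd.toList.length = P.γ n
  swap
  · simp only [hb, decide_false, if_true, if_false, false_and]
    exact answers_pure h (by simp [e₃]) (by simp [PMF_pure_eq])
  simp only [hb, decide_true, reduceCtorEq, if_false, true_and]
  -- the index
  obtain ⟨w₄, h₁₆, h₁₇, h₁₈, h₁₉⟩ := denote_find_index (a := a) h w₃ (e₃ 6 (by omega) (by omega)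
    (by omega) (by omega) (by omega)) (.tl (.tl (.tl (.tl (.reg 7)))))
  simp only [Expr.eval, e₃ 7 (by omega) (by omega) (by omega) (by omega) (by omega)] at h₁₈ h₁₉
  simp only [h₁₆, PMF.pure_bind, h₁₈]
  have e₄ : ∀ k, k ≠ 8 → k ≠ 9 → k ≠ 10 → k ≠ 13 → k ≠ 16 → w₄ k = w k :=
    fun k _ _ _ _ _ => by simp [*]
  by_cases hi : (w 7).tl.tl.tl.tl.toNat < P.γ n
  swap
  · simp only [hi, not_false_eq_true, if_true, if_false]
    exact answers_pure h (by simp [e₄]) (by simp [PMF_pure_eq])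
  simp only [hi, not_true, if_true, if_false, PMF_bind_eq, PMF_pure_eq, h₁₉]
  generalize (w 7).tl.tl.tl.tl.toNat = i at *
  -- the dummy request
  have e16'' : Function.update w₄ 14 (.num i) 16 = (w 7).tl.tl.tl.hd := by
    simp [h₁₇, h₁₄, e16']
  rw [← e16'']
  refine (dummyIndexProg_couples (a := a) h (Function.update w₄ 14 (.num i)) (by simp [e₄]) x).bind ?_
  rintro ⟨w₅, y⟩ j ⟨h₂₀, h₂₁, h₂₂, h₂₃⟩
  obtain rfl : y = x := h₂₀
  dsimp only at h₂₁ h₂₃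
  have hj := h₂₂ (by omega)
  have e₅ : ∀ k, k ≠ 8 → k ≠ 9 → k ≠ 10 → k ≠ 11 → k ≠ 13 → k ≠ 14 → k ≠ 16 → k ≠ 17 →
      w₅ k = w k := fun k _ _ _ _ _ _ _ _ => by simp [*]
  have e14 : w₅ 14 = .num i := by simp [h₂₃]
  obtain ⟨hx, h4⟩ : y = none ∧ (w 4).toList = st.requests.map Request.encode := by
    rcases h.requests with ⟨_, h', h''⟩ | ⟨h', _⟩
    · exact ⟨h', h''⟩
    · simp [hc] at h'
  have hle := h.requests_le
  -- the two new sessions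
  have hcall : P.ot.challenger n a y (Function.update w₅ 12 (Expr.eval w₅
      (if second then .cons (.reg 11) (.reg 14) else .cons (.reg 14) (.reg 11))) 12) =
      PMF.pure (some ⟨if second then (if a then i else j) else (if a then j else i), .nil⟩,
        .ofBool true) := by
    rw [Function.update_self, hx]
    cases second
    · simp only [Bool.false_eq_true, if_false, Expr.eval, h₂₁, e14, P.ot.challenger_none a hi hj]
    · simp only [if_true, Expr.eval, h₂₁, e14, P.ot.challenger_none a hj hi]
  rw [hcall]
  simp only [PMF.pure_map, PMF.pure_bind]
  generalize hw₆ : Function.update (Function.update w₅ 12 (Expr.eval w₅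
      (if second then .cons (.reg 11) (.reg 14) else .cons (.reg 14) (.reg 11)))) 12
      (.ofBool true) = w₆
  have e₆ : ∀ k, k ≠ 8 → k ≠ 9 → k ≠ 10 → k ≠ 11 → k ≠ 12 → k ≠ 13 → k ≠ 14 → k ≠ 16 → k ≠ 17 →
      w₆ k = w k := fun k k₁ k₂ k₃ k₄ k₅ k₆ k₇ k₈ k₉ => by
    rw [← hw₆, Function.update_of_ne k₅, Function.update_of_ne k₅, e₅ k k₁ k₂ k₃ k₄ k₆ k₇ k₈ k₉]
  have e11 : w₆ 11 = .num j := by simp [← hw₆, h₂₁]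
  obtain ⟨w₇, h₂₄, h₂₅, h₂₆⟩ := denote_push (P.ot.challenger n a) n (L := L + 2) (l := 4)
    (e := if second then .cons (.reg 11) .nil else .nil) (w := w₆) (by omega)
    (by simp [e₆, h.toNat_requests]; omega)
  obtain ⟨w₈, h₂₇, h₂₈, h₂₉⟩ := denote_push (P.ot.challenger n a) n (L := L + 2) (l := 4)
    (e := if second then .nil else .cons (.reg 11) .nil) (w := w₇) (by omega)
    (by simp [Data.toNat, h₂₆, e₆, h4]; omega)
  simp only [h₂₄, h₂₇, PMF.pure_bind]
  refine .pure ⟨h.challenge second _ _ _ _ ?_ h4 ?_ ?_, ?_⟩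
  · cases second <;> cases a <;> rfl
  · cases second <;> simp [h₂₉, h₂₆, e₆, Expr.eval, h₂₅, e11]
  · simp [h₂₈, h₂₅, e₆, Data.ofBool]
  · simp [h₂₈, h₂₅, e11]

/-! ### The reduction -/

/-- The honest users, with one of the OT sessions of the challenge left to the receiver in the OT
game: the second one if `second` is true, and the first one otherwise. -/
def usersProg (P : AOT) (second : Bool) : Prog :=
  dispatch (.hd (.reg 7)) (P.challengeProg second)
    [P.newUserProg, P.meetProg, meetCorruptProg, setDirectoryProg, P.sendProg, P.fetchProg,
      P.dummyProg, P.deliverProg]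

theorem usersProg_answers (h : Related P n L w x st) (second : Bool) :
    Answers P n a L (P.usersProg second) w x
      (P.hybridAnswer n (if second then true else a) (if second then !a else true) st
        (Query.decode (w 7))) := by
  rw [Answers, usersProg, denote_dispatch, Query.decode]
  simp only [Expr.eval]
  rcases (w 7).hd.toNat with _ | _ | _ | _ | _ | _ | _ | _ | k
  · exact newUser_answers h
  · exact meet_answers h
  · exact meetCorrupt_answers h
  · exact setDirectory_answers h
  · exact send_answers h
  · exact fetch_answers h
  · exact dummy_answers h
  · exact deliver_answers h
  · exact challenge_answers h second

end AOT

/-! ### Advantages -/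

/-- The probability that the guess of a machine with output distribution `p` is `true`. -/
noncomputable def guessTrueProb (p : PMF Data) : ℝ :=
  ((p.map fun out => decide (out ≠ .nil)) true).toReal

theorem abs_guessProb_sub {Inp : ℕ → Set Data} (A : PPT Inp) {σ : Type} (O : Bool → Party σ)
    (s : σ) (n : ℕ) (d : Data) :
    |guessProb A O s n d - 1 / 2| =
      |guessTrueProb (A.interact (O true) s n d) - guessTrueProb (A.interact (O false) s n d)| / 2 := by
  have h1 : ∀ p : PMF Bool, (p.map fun g => g == true) true = p true := fun p => by
    simp
  have h2 : ∀ p : PMF Bool, ((p.map fun g => g == false) true).toReal = 1 - (p true).toReal :=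
    fun p => by
    have hs : p false + p true = 1 := by
      have := p.tsum_coe
      rwa [tsum_bool] at this
    have e : (p.map fun g => g == false) true = p false := by
      rw [PMF.map_apply, tsum_bool]; simp
    rw [e, ← ENNReal.toReal_one, ← hs, ENNReal.toReal_add (PMF.apply_ne_top _ _) (PMF.apply_ne_top _ _)]
    ring
  have h3 : guessProb A O s n d = (guessTrueProb (A.interact (O true) s n d) +
      (1 - guessTrueProb (A.interact (O false) s n d))) / 2 := by
    have e : ∀ b, (A.interact (O b) s n d).map (fun out => decide (out ≠ .nil) == b) =
      ((A.interact (O b) s n d).map fun out => decide (out ≠ .nil)).map fun g => g == b := fun b => by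
      rw [PMF.map_comp]; rfl
    rw [guessProb, PMF.bind_apply, tsum_bool]
    simp only [e]
    rw [ENNReal.toReal_add (ENNReal.mul_ne_top (PMF.apply_ne_top _ _) (PMF.apply_ne_top _ _))
      (ENNReal.mul_ne_top (PMF.apply_ne_top _ _) (PMF.apply_ne_top _ _)), ENNReal.toReal_mul,
      ENNReal.toReal_mul, h2, h1]
    simp only [PMF.uniformOfFintype_apply, Fintype.card_bool, guessTrueProb]
    norm_num
    ring
  rw [h3, ← abs_two (α := ℝ), ← abs_div, abs_two]
  congr 1
  ring

namespace AOT

open Prog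

/-- The honest users in the hybrid games. -/
noncomputable def hybrid (P : AOT) (n : ℕ) (v₀ v₁ : Bool) : Party Users :=
  fun st q => P.hybridAnswer n v₀ v₁ st (Query.decode q)

theorem challenger_eq_hybrid (P : AOT) (n : ℕ) (b : Bool) :
    P.challenger n b = P.hybrid n b (!b) := by
  funext st q
  exact P.answer_eq_hybridAnswer n b st _

/-- The adversary `A` in the anonymity game, turned into a malicious sender in the OT game: it plays
the honest users, except for one of the OT sessions of the challenge. -/
noncomputable def sender (P : AOT) (A : P.ot.Adversary) (second : Bool) : P.ot.Adversary :=
  (P.usersProg second).reduction A P.ot.size_le.choose P.ot.size_le.choose_spec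

/-- The sender plays one of the hybrid games, which one depending on the bit `a` of the OT game. For
`second = false` the choices are `(m, m')` or `(m', m')`, and for `second = true` they are `(m', m')`
or `(m', m)`. -/
theorem sender_interact (P : AOT) (A : P.ot.Adversary) (second a : Bool) (n : ℕ) :
    (P.sender A second).interact (P.ot.challenger n a) none n (.num (P.γ n)) =
      A.interact (P.hybrid n (if second then true else a) (if second then !a else true))
        Users.init n (.num (P.γ n)) := by
  refine (reduction_interact _ _ _ _ _ _ _).trans ?_
  refine (Couples.steps (R := fun y st => Related P n y.1.2 y.1.1 y.2 st) ?_ _ _ ?_).eq_map ?_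
  · rintro ⟨⟨w, L⟩, x⟩ st q h
    have h' := usersProg_answers (a := a) (w := Function.update w 7 q) (x := x) (st := st) (L := L)
      ⟨by simpa using h.users, by simpa using h.contacts, by simpa using h.directory,
        by simpa using h.challenged, by simpa using h.size, h.size_le, h.users_le, h.contacts_le,
        h.requests_le, by simpa using h.requests⟩ second
    rw [Function.update_self] at h'
    have := h'.map (f := fun r => (((r.1, L + 2), r.2), r.1 7)) (f' := id)
      (R' := fun r₁ r₂ => Related P n r₁.1.1.2 r₁.1.1.1 r₁.1.2 r₂.1 ∧ r₁.2 = r₂.2) fun _ _ => id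
    rwa [PMF.map_id] at this
  · constructor <;> simp [initStore, Users.init, Data.ofBool, γ]
  · rintro ⟨c₁, y₁⟩ ⟨c₂, y₂⟩ ⟨h, -⟩
    obtain rfl : c₁ = c₂ := h
    rfl

theorem advantage_le (P : AOT) (A : P.ot.Adversary) (n : ℕ) :
    P.advantage A n ≤
      P.ot.advantage (P.sender A false) n + P.ot.advantage (P.sender A true) n := by
  rw [advantage, OT.advantage, OT.advantage, abs_guessProb_sub, abs_guessProb_sub,
    abs_guessProb_sub]
  have h := fun second a => P.sender_interact A second a n
  simp only [γ] at h
  simp only [h, challenger_eq_hybrid, if_true, Bool.not_true, Bool.not_false, Bool.false_eq_true,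
    if_false, γ]
  generalize guessTrueProb (A.interact (P.hybrid n true false) _ _ _) = p₁
  generalize guessTrueProb (A.interact (P.hybrid n false true) _ _ _) = p₂
  generalize guessTrueProb (A.interact (P.hybrid n true true) _ _ _) = p₃
  have h₁ := abs_sub_le p₁ p₃ p₂
  have h₂ := abs_sub_comm p₁ p₃
  linarith

end AOT

end ObliviousAnon

theorem theorem1 (P : ObliviousAnon.AOT) (h : P.ot.ReceiverSecurity) :
    P.ReceiverAnonymity := by
  intro A
  refine Asymptotics.SuperpolynomialDecay.trans_abs_le
    ((h (P.sender A false)).add (h (P.sender A true))) fun n => ?_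
  rw [abs_of_nonneg (show 0 ≤ P.advantage A n from abs_nonneg _)]
  exact (P.advantage_le A n).trans (le_abs_self _)
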